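/- **Theorem 4 (complexity of the deterministic GDGA algorithm).** Let $f:\mathbb{R}^d\to\mathbb{R}$ be differentiable with $\ell$-Lipschitz gradient and $\mu$-strongly convex ($\mu>0$), $\kappa=\ell/\mu$, let $0\ne D\in\mathbb{R}^{m\times d}$, $\lambda>0$, let $\sigma$ be the largest eigenvalue of $DD^\top$, and let $\beta^*$ be the minimizer of $\Phi(\beta)=f(\beta)+\lambda\|D\beta\|_1$. Let $B_\infty(\lambda)=\{\alpha\in\mathbb{R}^m:\|\alpha\|_\infty\le\lambda\}$ and $\beta^*(\alpha)=\operatorname{argmin}_\beta\{f(\beta)-\alpha^\top D\beta\}$. Let $\tau=\theta(D)^2\,\ell\,(1+\sigma/\mu)$, where $\theta(D)$ is the supremum of $\|(u_1,u_2,v)\|$ over $u_1,u_2\in\mathbb{R}^d_{\ge0}$, $v\in\mathbb{R}^m$ with $\|u_1-u_2+D^\top v\|=1$ such that the columns of $[I_d,-I_d,D^\top]$ belonging to the nonzero entries of $(u_1,u_2,v)$ are linearly independent. The deterministic GDGA algorithm with step size $\eta>0$ and inner tolerance $\hat\varepsilon\in(0,1)$, started at $\beta_{-1}\in\mathbb{R}^d$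 and $\alpha_0\in B_\infty(\lambda)$, does the following for $t=0,1,\dots$: it runs Nesterov's accelerated gradient method (step size $1/\ell$, $\gamma_0=\ell$) on $\beta\mapsto f(\beta)-\alpha_t^\top D\beta$ from the starting point $\beta_{t-1}$ until its iterate $\beta_t$ satisfies $\|\beta_t-\beta^*(\alpha_t)\|\le\hat\varepsilon$, which takes $N_t$ evaluations of $\nabla f$, and sets $\alpha_{t+1}=\operatorname{proj}_{B_\infty(\lambda)}(\alpha_t-\eta D\beta_t)$. There is an absolute constant $c>0$ such that, for all such data, if $\eta\in(0,\mu/(4\sigma))$, $\varepsilon>0$ and $$\hat\varepsilon\le\min\Big\{\frac{\sqrt\varepsilon}{2},\ \frac{\mu\sqrt\varepsilon}{4\sqrt\ell}\sqrt{\frac{\tau}{C\,(17\tau^2+(14+\eta)\tau+1)}}\Big\},\qquad C=\frac{2\tau^2\sigma}{17\tau^2+6\tau+9}+\frac{\sigma}{2\kappa},$$ then every inner run terminates, some iterate satisfies $\|\beta_t-\beta^*\|^2\le\varepsilon$, and the total number $\widetilde N_{\rm grad}=N_0+\dots+N_T$ of gradient oracle calls up to the first such iterate $\beta_T$ satisfies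 $$\widetilde N_{\rm grad}\le c\left[\frac{\sqrt\kappa\,(17\tau^2+14\tau+1)}{\tau\eta}\,\log^+\!\Big(\frac{64\,\ell\sigma\lambda^2m}{\mu^3\varepsilon}\Big)\log\Big(\frac{1+2\lambda\sqrt{\sigma m}/\mu}{\hat\varepsilon}\Big)+\sqrt\kappa\,\log\Big(1+\frac{\|\beta_{-1}-\beta^*(\alpha_0)\|}{\hat\varepsilon}\Big)\right],$$ where $\log^+x=\max\{0,\log x\}$. -/

import Mathlib

open scoped Gradient

noncomputable section

namespace GDGA

/-- The standing assumption on the loss: `f` is differentiable, its gradient is `ℓ`-Lipschitz, and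
`f` is `μ`-strongly convex (expressed through the gradient). -/
structure IsRegularLoss {d : ℕ} (f : EuclideanSpace ℝ (Fin d) → ℝ) (μ ℓ : ℝ) : Prop where
  differentiable : Differentiable ℝ f
  gradient_lipschitz : ∀ x y, ‖∇ f x - ∇ f y‖ ≤ ℓ * ‖x - y‖
  strongly_convex : ∀ x y, μ * ‖x - y‖ ^ 2 ≤ inner ℝ (x - y) (∇ f x - ∇ f y)

/-- The filtering-clustering objective `Φ(β) = f(β) + lam ‖D β‖₁`. -/
def objective {m d : ℕ} (f : EuclideanSpace ℝ (Fin d) → ℝ) (D : Matrix (Fin m) (Fin d) ℝ)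
    (lam : ℝ) (β : EuclideanSpace ℝ (Fin d)) : ℝ :=
  f β + lam * ∑ i, |D.toEuclideanLin β i|

/-- The function `β ↦ f(β) - αᵀ D β` that is (approximately) minimized in the inner problem. -/
def lagrangian {m d : ℕ} (f : EuclideanSpace ℝ (Fin d) → ℝ) (D : Matrix (Fin m) (Fin d) ℝ)
    (α : EuclideanSpace ℝ (Fin m)) (β : EuclideanSpace ℝ (Fin d)) : ℝ :=
  f β - inner ℝ α (D.toEuclideanLin β)

/-- The gradient `∇ f(β) - Dᵀ α` of `β ↦ f(β) - αᵀ D β`. One evaluation costs exactly one call of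
the oracle `∇ f`. -/
def lagrangianGrad {m d : ℕ} (f : EuclideanSpace ℝ (Fin d) → ℝ) (D : Matrix (Fin m) (Fin d) ℝ)
    (α : EuclideanSpace ℝ (Fin m)) (β : EuclideanSpace ℝ (Fin d)) : EuclideanSpace ℝ (Fin d) :=
  ∇ f β - D.transpose.toEuclideanLin α

/-- `x` is an `r`-minimizer of `g`: it lies within distance `r` of a global minimizer of `g`. -/
def IsApproxMinimizer {d : ℕ} (g : EuclideanSpace ℝ (Fin d) → ℝ) (r : ℝ)
    (x : EuclideanSpace ℝ (Fin d)) : Prop :=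
  ∃ b, IsMinOn g Set.univ b ∧ ‖x - b‖ ≤ r

/-- `σ`, the largest eigenvalue of `D Dᵀ`. -/
def sigmaMax {m d : ℕ} (D : Matrix (Fin m) (Fin d) ℝ) : ℝ :=
  sSup (spectrum ℝ (D * D.transpose))

/-- The columns of the block matrix `[I_d, -I_d, Dᵀ]`, as vectors of `ℝ^d`. -/
def blockColumn {m d : ℕ} (D : Matrix (Fin m) (Fin d) ℝ) :
    Fin d ⊕ Fin d ⊕ Fin m → EuclideanSpace ℝ (Fin d)
  | Sum.inl i => EuclideanSpace.single i 1
  | Sum.inr (Sum.inl i) => -EuclideanSpace.single i 1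
  | Sum.inr (Sum.inr j) => WithLp.toLp 2 (D j)

/-- The Hoffman-type constant `θ(D)`: the supremum of `‖(u₁, u₂, v)‖` over `u₁, u₂ ∈ ℝ^d`,
`v ∈ ℝ^m` with `u₁, u₂ ≥ 0` and `‖u₁ - u₂ + Dᵀ v‖ = 1` such that the columns of `[I_d, -I_d, Dᵀ]`
that belong to the nonzero entries of `c = (u₁, u₂, v)` are linearly independent. -/
def theta {m d : ℕ} (D : Matrix (Fin m) (Fin d) ℝ) : ℝ :=
  sSup {r : ℝ | ∃ c : EuclideanSpace ℝ (Fin d ⊕ Fin d ⊕ Fin m),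
    (∀ i : Fin d, 0 ≤ c (Sum.inl i)) ∧ (∀ i : Fin d, 0 ≤ c (Sum.inr (Sum.inl i))) ∧
    ‖∑ k, c k • blockColumn D k‖ = 1 ∧
    LinearIndependent ℝ (fun k : {k // c k ≠ 0} => blockColumn D k.1) ∧
    r = ‖c‖}

/-- The error bound constant `τ = θ(D)² ℓ (1 + σ/μ)`. -/
def tau {m d : ℕ} (D : Matrix (Fin m) (Fin d) ℝ) (μ ℓ : ℝ) : ℝ :=
  theta D ^ 2 * ℓ * (1 + sigmaMax D / μ)

/-- The constant `2τ²σ / (17τ² + 6τ + 9) + σ / (2κ)` of the condition on the inner tolerance. -/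
def tolConst (τ σ κ : ℝ) : ℝ :=
  2 * τ ^ 2 * σ / (17 * τ ^ 2 + 6 * τ + 9) + σ / (2 * κ)

/-- The box `{α | ‖α‖_∞ ≤ lam}`. -/
def box (m : ℕ) (lam : ℝ) : Set (EuclideanSpace ℝ (Fin m)) :=
  {α | ∀ i, |α i| ≤ lam}

/-- The Euclidean projection onto the box: coordinatewise clipping to `[-lam, lam]`. -/
def boxProj {m : ℕ} (lam : ℝ) (α : EuclideanSpace ℝ (Fin m)) : EuclideanSpace ℝ (Fin m) :=
  WithLp.toLp 2 (fun i => max (-lam) (min lam (α i)))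

theorem boxProj_mem {m : ℕ} {lam : ℝ} (hl : 0 ≤ lam) (α : EuclideanSpace ℝ (Fin m)) :
    boxProj lam α ∈ box m lam := by
  intro i
  simp only [boxProj]
  rw [abs_le]
  exact ⟨le_max_left _ _, max_le (by linarith) (min_le_left _ _)⟩

/-- Clipping yields a nearest point of the box. -/
theorem norm_sub_boxProj_le {m : ℕ} {lam : ℝ} (α y : EuclideanSpace ℝ (Fin m))
    (hy : y ∈ box m lam) : ‖α - boxProj lam α‖ ≤ ‖α - y‖ := by
  rw [EuclideanSpace.norm_eq, EuclideanSpace.norm_eq]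
  apply Real.sqrt_le_sqrt
  apply Finset.sum_le_sum
  intro i _
  have h := abs_le.1 (hy i)
  simp only [boxProj, PiLp.sub_apply, Real.norm_eq_abs]
  apply pow_le_pow_left₀ (abs_nonneg _)
  rcases le_total lam (α i) with h1 | h1
  · rw [min_eq_left h1, max_eq_right (by linarith), abs_of_nonneg (by linarith)]
    exact le_trans (by linarith) (le_abs_self _)
  · rw [min_eq_right h1]
    rcases le_total (-lam) (α i) with h2 | h2
    · rw [max_eq_right h2]
      simp
    · rw [max_eq_left h2, abs_of_nonpos (by linarith)]
      exact le_trans (by linarith) (neg_le_abs _)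

/-- The state `(x_k, v_k, γ_k)` of accelerated gradient descent. -/
structure AGDState (d : ℕ) where
  x : EuclideanSpace ℝ (Fin d)
  v : EuclideanSpace ℝ (Fin d)
  γ : ℝ

/-- The positive root `a` of `ℓ a² = (1 - a) γ + a μ`. -/
def agdWeight (μ ℓ γ : ℝ) : ℝ :=
  (μ - γ + Real.sqrt ((μ - γ) ^ 2 + 4 * ℓ * γ)) / (2 * ℓ)

/-- One step of Nesterov's accelerated gradient method for `μ`-strongly convex functions with
`ℓ`-Lipschitz gradient `G`, with step size `1/ℓ`. The gradient is evaluated once, at `y`. -/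
def agdStep {d : ℕ} (μ ℓ : ℝ) (G : EuclideanSpace ℝ (Fin d) → EuclideanSpace ℝ (Fin d))
    (s : AGDState d) : AGDState d :=
  let a := agdWeight μ ℓ s.γ
  let γ' := (1 - a) * s.γ + a * μ
  let y := (s.γ + a * μ)⁻¹ • ((a * s.γ) • s.v + γ' • s.x)
  let g := G y
  { x := y - ℓ⁻¹ • g
    v := γ'⁻¹ • (((1 - a) * s.γ) • s.v + (a * μ) • y - a • g)
    γ := γ' }

/-- The point `x_k` reached by accelerated gradient descent from `x₀` (with `v₀ = x₀`, `γ₀ = ℓ`)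
after `k` steps, hence after `k` evaluations of the gradient `G`. -/
def agd {d : ℕ} (μ ℓ : ℝ) (G : EuclideanSpace ℝ (Fin d) → EuclideanSpace ℝ (Fin d))
    (x₀ : EuclideanSpace ℝ (Fin d)) (k : ℕ) : EuclideanSpace ℝ (Fin d) :=
  ((agdStep μ ℓ G)^[k] { x := x₀, v := x₀, γ := ℓ }).x

/-- The number of gradient evaluations that accelerated gradient descent, started at `x₀`, needs
until its iterate is an `r`-minimizer of `β ↦ f(β) - αᵀ D β`. -/
def innerCalls {m d : ℕ} (f : EuclideanSpace ℝ (Fin d) → ℝ) (D : Matrix (Fin m) (Fin d) ℝ)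
    (μ ℓ r : ℝ) (α : EuclideanSpace ℝ (Fin m)) (x₀ : EuclideanSpace ℝ (Fin d)) : ℕ :=
  sInf {k : ℕ | IsApproxMinimizer (lagrangian f D α) r (agd μ ℓ (lagrangianGrad f D α) x₀ k)}

/-- The output of the inner solver. -/
def innerSolve {m d : ℕ} (f : EuclideanSpace ℝ (Fin d) → ℝ) (D : Matrix (Fin m) (Fin d) ℝ)
    (μ ℓ r : ℝ) (α : EuclideanSpace ℝ (Fin m)) (x₀ : EuclideanSpace ℝ (Fin d)) :
    EuclideanSpace ℝ (Fin d) :=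
  agd μ ℓ (lagrangianGrad f D α) x₀ (innerCalls f D μ ℓ r α x₀)

/-- The data of a run of the deterministic algorithm. -/
structure Run (m d : ℕ) where
  /-- the loss -/
  f : EuclideanSpace ℝ (Fin d) → ℝ
  /-- the difference operator -/
  D : Matrix (Fin m) (Fin d) ℝ
  /-- the regularization parameter -/
  lam : ℝ
  /-- strong convexity modulus used by the inner solver -/
  μ : ℝ
  /-- Lipschitz constant of the gradient used by the inner solver -/
  ℓ : ℝ
  /-- dual step size -/
  η : ℝ
  /-- inner tolerance -/
  epsHat : ℝ
  /-- initial primal point `β₋₁` -/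
  βinit : EuclideanSpace ℝ (Fin d)
  /-- initial dual point `α₀` -/
  α₀ : EuclideanSpace ℝ (Fin m)

/-- The pair `(α_t, β_{t-1})`. The `t`-th inner problem is solved by accelerated gradient descent
started at `β_{t-1}`; its output is `β_t`, and `α_{t+1} = proj (α_t - η D β_t)`. -/
def Run.state {m d : ℕ} (R : Run m d) : ℕ → EuclideanSpace ℝ (Fin m) × EuclideanSpace ℝ (Fin d)
  | 0 => (R.α₀, R.βinit)
  | t + 1 =>
    let α := (R.state t).1
    let β := innerSolve R.f R.D R.μ R.ℓ R.epsHat α (R.state t).2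
    (boxProj R.lam (α - R.η • R.D.toEuclideanLin β), β)

/-- The dual iterate `α_t`. -/
def Run.dual {m d : ℕ} (R : Run m d) (t : ℕ) : EuclideanSpace ℝ (Fin m) := (R.state t).1

/-- The primal iterate `β_t`. -/
def Run.primal {m d : ℕ} (R : Run m d) (t : ℕ) : EuclideanSpace ℝ (Fin d) := (R.state (t + 1)).2

/-- The number `N_t` of gradient oracle calls used to compute `β_t`. -/
def Run.calls {m d : ℕ} (R : Run m d) (t : ℕ) : ℕ :=
  innerCalls R.f R.D R.μ R.ℓ R.epsHat (R.state t).1 (R.state t).2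

/-- The total number `N_0 + ⋯ + N_T` of gradient oracle calls used to compute `β_0, …, β_T`. -/
def Run.totalCalls {m d : ℕ} (R : Run m d) (T : ℕ) : ℕ :=
  ∑ t ∈ Finset.range (T + 1), R.calls t

end GDGA

end

noncomputable section

namespace GDGA

/-! The outer loop is inexact projected gradient ascent over the box on the concave dual function
`g(α) = min_β L(α, β)`, where `L` is `lagrangian` and the gradient is `-D β*(α)`. Strong convexity
of `f` makes `g` smooth with constant `σ/μ`, so `η σ ≤ μ` suffices for descent (`dual_step`). In
general `g` is not strongly concave, as `Dᵀ` may have a kernel. However, the `ℓ`-Lipschitz gradient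
makes the dual gap at least `‖Dᵀ(α - α*)‖² / (2ℓ)` (`dual_gap_bounds`), and a Hoffman bound
(`exists_mem_box_near`) turns this into a bound on the distance to `{p ∈ box | Dᵀ p = Dᵀ α*}`, all
of whose points have the same Lagrangian as `α*`. The gap thus dominates `dist² / (8 ℓ θ²)`.

An inner error `r` enters only through `Dᵀ(p - α)`, which the gap controls as well, so it costs `O(η
ℓ r²)` per step with no diameter factor. While the primal iterate is inaccurate the gap is at least
`μ ε / 8`, which outweighs this cost. Hence `dist²` shrinks by the factor `1 + η / (16 ℓ θ²)` per
step (`exists_dual_near`). Since `‖β*(α) - β*‖ ≤ √σ · dist / μ`, inaccuracy cannot last more than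
order `τ/η` times a logarithm steps.

Each inner run takes `O(√κ log(1 + dist/r))` steps (`exists_agd_dist_le`). From the second run on,
the starting point is the previous output, and minimizers for two points of the box lie at most
`2λ√(σm)/μ` apart. Only the first run sees the distance of `β₋₁`. -/

theorem le_of_hasDerivAt_le_affine {φ φ' : ℝ → ℝ} {A c : ℝ}
    (hφ : ∀ t, HasDerivAt φ (φ' t) t) (h : ∀ t, 0 ≤ t → φ' t ≤ A + c * t) :
    φ 1 ≤ φ 0 + A + c / 2 := by
  have hd : ∀ t : ℝ, HasDerivAt (fun t => φ t - A * t - c / 2 * t ^ 2) (φ' t - A - c * t) t := by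
    intro t
    have h1 := ((hφ t).sub ((hasDerivAt_id t).const_mul A)).sub
      (((hasDerivAt_id t).pow 2).const_mul (c / 2))
    refine h1.congr_deriv ?_
    simp
    ring
  have hanti : AntitoneOn (fun t => φ t - A * t - c / 2 * t ^ 2) (Set.Icc 0 1) := by
    apply antitoneOn_of_deriv_nonpos (convex_Icc 0 1)
    · exact fun t _ => (hd t).continuousAt.continuousWithinAt
    · exact fun t _ => (hd t).differentiableAt.differentiableWithinAt
    · intro t ht
      rw [interior_Icc] at ht
      rw [(hd t).deriv]
      linarith [h t ht.1.le]
  have := hanti (Set.left_mem_Icc.2 zero_le_one) (Set.right_mem_Icc.2 zero_le_one) zero_le_one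
  simp only at this
  linarith

/-! ### Smooth strongly convex functions. -/

namespace IsRegularLoss

variable {d : ℕ} {f : EuclideanSpace ℝ (Fin d) → ℝ} {μ ℓ : ℝ}

theorem hasDerivAt_line (h : IsRegularLoss f μ ℓ) (x v : EuclideanSpace ℝ (Fin d)) (t : ℝ) :
    HasDerivAt (fun t : ℝ => f (x + t • v)) (inner ℝ (∇ f (x + t • v)) v) t := by
  have h1 := (h.differentiable (x + t • v)).hasGradientAt.hasFDerivAt
  have h2 : HasDerivAt (fun t : ℝ => x + t • v) v t := by
    simpa using ((hasDerivAt_id t).smul_const v).const_add x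
  have h3 := h1.comp_hasDerivAt t h2
  exact h3

theorem upper_bound (h : IsRegularLoss f μ ℓ) (x y : EuclideanSpace ℝ (Fin d)) :
    f y ≤ f x + inner ℝ (∇ f x) (y - x) + ℓ / 2 * ‖y - x‖ ^ 2 := by
  have h1 := le_of_hasDerivAt_le_affine (A := inner ℝ (∇ f x) (y - x)) (c := ℓ * ‖y - x‖ ^ 2)
    (h.hasDerivAt_line x (y - x)) ?_
  · simp only [one_smul, zero_smul, add_zero, add_sub_cancel] at h1
    linarith
  · intro t ht
    have h2 : inner ℝ (∇ f (x + t • (y - x)) - ∇ f x) (y - x) ≤ _ := real_inner_le_norm _ _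
    have h3 := h.gradient_lipschitz (x + t • (y - x)) x
    rw [add_sub_cancel_left, norm_smul, Real.norm_of_nonneg ht] at h3
    rw [inner_sub_left] at h2
    nlinarith [mul_le_mul_of_nonneg_right h3 (norm_nonneg (y - x))]

theorem lower_bound (h : IsRegularLoss f μ ℓ) (x y : EuclideanSpace ℝ (Fin d)) :
    f x + inner ℝ (∇ f x) (y - x) + μ / 2 * ‖y - x‖ ^ 2 ≤ f y := by
  have h1 := le_of_hasDerivAt_le_affine (A := -inner ℝ (∇ f x) (y - x))
    (c := -(μ * ‖y - x‖ ^ 2)) (fun t => (h.hasDerivAt_line x (y - x) t).neg) ?_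
  · simp only [Pi.neg_apply, one_smul, zero_smul, add_zero, add_sub_cancel] at h1
    linarith
  · intro t ht
    have h3 := h.strongly_convex (x + t • (y - x)) x
    rw [add_sub_cancel_left, norm_smul, Real.norm_of_nonneg ht, real_inner_smul_left,
      real_inner_comm, inner_sub_left] at h3
    rcases ht.eq_or_lt with rfl | ht
    · simp
    · have : μ * (t * ‖y - x‖ ^ 2) ≤
          inner ℝ (∇ f (x + t • (y - x))) (y - x) - inner ℝ (∇ f x) (y - x) := by
        refine le_of_mul_le_mul_left ?_ ht
        linarith
      linarith

theorem gradient_eq_zero (_h : IsRegularLoss f μ ℓ) {b : EuclideanSpace ℝ (Fin d)}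
    (hb : IsMinOn f Set.univ b) : ∇ f b = 0 := by
  have : IsLocalMin f b := hb.isLocalMin Filter.univ_mem
  simp [gradient, this.fderiv_eq_zero]

theorem quadratic_growth (h : IsRegularLoss f μ ℓ) {b : EuclideanSpace ℝ (Fin d)}
    (hb : IsMinOn f Set.univ b) (x : EuclideanSpace ℝ (Fin d)) :
    μ / 2 * ‖x - b‖ ^ 2 ≤ f x - f b := by
  have := h.lower_bound b x
  rw [h.gradient_eq_zero hb, inner_zero_left] at this
  linarith

theorem isMinOn_unique (h : IsRegularLoss f μ ℓ) (hμ : 0 < μ) {b b' : EuclideanSpace ℝ (Fin d)}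
    (hb : IsMinOn f Set.univ b) (hb' : IsMinOn f Set.univ b') : b = b' := by
  have h1 := h.quadratic_growth hb' b
  have h2 : f b ≤ f b' := hb (Set.mem_univ b')
  have h3 : ‖b - b'‖ ^ 2 ≤ 0 := by
    by_contra hc
    push Not at hc
    have : 0 < μ / 2 * ‖b - b'‖ ^ 2 := by positivity
    linarith
  have h4 : ‖b - b'‖ = 0 := by nlinarith [norm_nonneg (b - b')]
  exact sub_eq_zero.1 (norm_eq_zero.1 h4)

theorem exists_isMinOn (h : IsRegularLoss f μ ℓ) (hμ : 0 < μ) :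
    ∃ b, IsMinOn f Set.univ b := by
  have hc : Continuous f := h.differentiable.continuous
  obtain ⟨b, hb⟩ := hc.exists_forall_le' (0 : EuclideanSpace ℝ (Fin d)) (by
    rw [← Metric.cobounded_eq_cocompact]
    filter_upwards [Bornology.isBounded_def.1
      -- Beyond this radius `μ/2 ‖x‖²` outweighs `‖∇ f 0‖ ‖x‖`, so `f x ≥ f 0`.
      (Metric.isBounded_closedBall (x := (0 : EuclideanSpace ℝ (Fin d))) (r := 2 * ‖∇ f 0‖ / μ))]
      with x hx
    have h1 := h.lower_bound 0 x
    have h2 : -(‖∇ f 0‖ * ‖x‖) ≤ inner ℝ (∇ f 0) x :=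
      (abs_le.1 (abs_real_inner_le_norm _ _)).1
    simp only [Set.mem_compl_iff, Metric.mem_closedBall, dist_zero_right, not_le] at hx
    rw [div_lt_iff₀ hμ] at hx
    rw [sub_zero] at h1
    nlinarith [norm_nonneg x])
  exact ⟨b, fun y _ => hb y⟩

/-- A gradient step of size `1/ℓ` from `x` lowers `f` by at least the left-hand side, and cannot go
below the minimum. -/
theorem gap_ge (h : IsRegularLoss f μ ℓ) (hℓ : 0 < ℓ) {b : EuclideanSpace ℝ (Fin d)}
    (hb : IsMinOn f Set.univ b) (x : EuclideanSpace ℝ (Fin d)) :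
    ‖∇ f x‖ ^ 2 / (2 * ℓ) ≤ f x - f b := by
  have h1 := h.upper_bound x (x - ℓ⁻¹ • ∇ f x)
  have h2 : f b ≤ f (x - ℓ⁻¹ • ∇ f x) := hb (Set.mem_univ _)
  rw [sub_sub_cancel_left, inner_neg_right, real_inner_smul_right, real_inner_self_eq_norm_sq,
    norm_neg, norm_smul, Real.norm_of_nonneg (by positivity)] at h1
  have h3 : ‖∇ f x‖ ^ 2 / (2 * ℓ) =
      ℓ⁻¹ * ‖∇ f x‖ ^ 2 - ℓ / 2 * (ℓ⁻¹ * ‖∇ f x‖) ^ 2 := by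
    field_simp
    ring
  linarith

/-- Complete the square in the strong convexity lower bound around `x` (Polyak–Łojasiewicz). -/
theorem gap_le (h : IsRegularLoss f μ ℓ) (hμ : 0 < μ) (b x : EuclideanSpace ℝ (Fin d)) :
    f x - f b ≤ ‖∇ f x‖ ^ 2 / (2 * μ) := by
  have h1 := h.lower_bound x b
  have h2 : -(‖∇ f x‖ * ‖b - x‖) ≤ inner ℝ (∇ f x) (b - x) :=
    (abs_le.1 (abs_real_inner_le_norm _ _)).1
  have h3 : ‖∇ f x‖ ^ 2 / (2 * μ) + μ / 2 * ‖b - x‖ ^ 2 - ‖∇ f x‖ * ‖b - x‖ =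
      (‖∇ f x‖ - μ * ‖b - x‖) ^ 2 / (2 * μ) := by
    field_simp
    ring
  have h4 : 0 ≤ (‖∇ f x‖ - μ * ‖b - x‖) ^ 2 / (2 * μ) := by positivity
  linarith

theorem modulus_le (h : IsRegularLoss f μ ℓ) (hd : 0 < d) : μ ≤ ℓ := by
  have h1 := h.strongly_convex (EuclideanSpace.single ⟨0, hd⟩ 1) 0
  have h2 := h.gradient_lipschitz (EuclideanSpace.single ⟨0, hd⟩ 1) 0
  have h3 := real_inner_le_norm (EuclideanSpace.single (⟨0, hd⟩ : Fin d) (1 : ℝ) - 0)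
    (∇ f (EuclideanSpace.single ⟨0, hd⟩ 1) - ∇ f 0)
  have h4 : ‖EuclideanSpace.single (⟨0, hd⟩ : Fin d) (1 : ℝ) - 0‖ = 1 := by simp
  rw [h4] at h1 h2 h3
  linarith

end IsRegularLoss

/-! ### The Lagrangian as a linear perturbation of the loss. -/

section Lagrangian

variable {m d : ℕ} {f : EuclideanSpace ℝ (Fin d) → ℝ} {μ ℓ : ℝ} {D : Matrix (Fin m) (Fin d) ℝ}

theorem inner_toEuclideanLin (D : Matrix (Fin m) (Fin d) ℝ) (α : EuclideanSpace ℝ (Fin m))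
    (β : EuclideanSpace ℝ (Fin d)) :
    inner ℝ α (D.toEuclideanLin β) = inner ℝ (D.transpose.toEuclideanLin α) β := by
  have := LinearMap.adjoint_inner_left (D.toEuclideanLin) β α
  rw [← Matrix.toEuclideanLin_conjTranspose_eq_adjoint, Matrix.conjTranspose_eq_transpose_of_trivial]
    at this
  exact this.symm

theorem hasGradientAt_lagrangian (h : IsRegularLoss f μ ℓ) (α : EuclideanSpace ℝ (Fin m))
    (β : EuclideanSpace ℝ (Fin d)) :
    HasGradientAt (lagrangian f D α) (lagrangianGrad f D α β) β := by
  have h1 := (h.differentiable β).hasGradientAt.hasFDerivAt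
  have h2 := (InnerProductSpace.toDual ℝ _ (D.transpose.toEuclideanLin α)).hasFDerivAt (x := β)
  rw [hasGradientAt_iff_hasFDerivAt]
  have h3 := h1.sub h2
  rw [← map_sub] at h3
  refine h3.congr_of_eventuallyEq (Filter.Eventually.of_forall fun x => ?_)
  simp [lagrangian, inner_toEuclideanLin]

theorem gradient_lagrangian (h : IsRegularLoss f μ ℓ) (α : EuclideanSpace ℝ (Fin m)) :
    ∇ (lagrangian f D α) = lagrangianGrad f D α :=
  funext fun β => (hasGradientAt_lagrangian h α β).gradient

theorem IsRegularLoss.lagrangian (h : IsRegularLoss f μ ℓ) (α : EuclideanSpace ℝ (Fin m)) :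
    IsRegularLoss (lagrangian f D α) μ ℓ where
  differentiable β := (hasGradientAt_lagrangian h α β).differentiableAt
  gradient_lipschitz x y := by
    simpa [gradient_lagrangian h, lagrangianGrad] using h.gradient_lipschitz x y
  strongly_convex x y := by
    simpa [gradient_lagrangian h, lagrangianGrad] using h.strongly_convex x y

end Lagrangian

/-! ### Convergence of Nesterov's accelerated gradient method. -/

section AGD

variable {d : ℕ} {μ ℓ γ : ℝ}

theorem agdWeight_eq (hℓ : 0 < ℓ) (hγ : 0 < γ) :
    ℓ * agdWeight μ ℓ γ ^ 2 = (1 - agdWeight μ ℓ γ) * γ + agdWeight μ ℓ γ * μ := by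
  have h1 : Real.sqrt ((μ - γ) ^ 2 + 4 * ℓ * γ) ^ 2 = (μ - γ) ^ 2 + 4 * ℓ * γ :=
    Real.sq_sqrt (by positivity)
  have h2 : Real.sqrt ((μ - γ) ^ 2 + 4 * ℓ * γ) = 2 * ℓ * agdWeight μ ℓ γ - (μ - γ) := by
    unfold agdWeight
    field_simp
    ring
  rw [h2] at h1
  have h3 : 4 * ℓ * (ℓ * agdWeight μ ℓ γ ^ 2) =
      4 * ℓ * ((1 - agdWeight μ ℓ γ) * γ + agdWeight μ ℓ γ * μ) := by linarith
  exact mul_left_cancel₀ (by positivity) h3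

theorem agdWeight_pos (hℓ : 0 < ℓ) (hγ : 0 < γ) : 0 < agdWeight μ ℓ γ := by
  have h1 : |μ - γ| < Real.sqrt ((μ - γ) ^ 2 + 4 * ℓ * γ) := by
    rw [← Real.sqrt_sq_eq_abs]
    exact Real.sqrt_lt_sqrt (sq_nonneg _) (by nlinarith [mul_pos hℓ hγ])
  have := neg_abs_le (μ - γ)
  exact div_pos (by linarith) (by positivity)

theorem agdWeight_le_one (hℓ : 0 < ℓ) (hγ : 0 < γ) (hμℓ : μ ≤ ℓ) : agdWeight μ ℓ γ ≤ 1 := by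
  have h1 := agdWeight_eq (μ := μ) hℓ hγ
  have h2 := agdWeight_pos (μ := μ) hℓ hγ
  by_contra hc
  push Not at hc
  nlinarith [mul_le_mul_of_nonneg_right hμℓ h2.le, mul_pos (mul_pos hℓ h2) (sub_pos.2 hc),
    mul_pos (sub_pos.2 hc) hγ]

/-- Scalar core of the one-step contraction. With `g = ∇ f y`: `P = ‖v - y‖²`, `Q = ‖g‖²`, `Z = ‖b -
y‖²`, `pg`, `qg`, `zg` are the inner products of `g` with `v - y`, `x - y`, `b - y`, and `pz = ⟨v -
y, b - y⟩`. The choice of `y` as a combination of `v` and `x` gives `hbal`, which trades `pg` for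
`qg`. -/
theorem energy_scalar_inequality {a γ' fx fb fy fx' P Q Z pg qg zg pz : ℝ} (hℓ : 0 < ℓ)
    (ha : 0 < a) (ha1 : a ≤ 1) (hγ : 0 < γ) (hγ' : γ' = (1 - a) * γ + a * μ) (hγ'pos : 0 < γ')
    (haeq : ℓ * a ^ 2 = γ') (hP : 0 ≤ P) (hbal : a * γ * pg + γ' * qg = 0)
    (hup : fx' ≤ fy + -(ℓ⁻¹ * Q) + ℓ / 2 * (ℓ⁻¹ ^ 2 * Q)) (hlx : fy + qg ≤ fx)
    (hlb : fy + zg + μ / 2 * Z ≤ fb) (haμ : 0 < a * μ) :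
    fx' - fb + γ' / 2 * (γ'⁻¹ ^ 2 * (((1 - a) * γ) ^ 2 * P + a ^ 2 * Q + γ' ^ 2 * Z
        - 2 * ((1 - a) * γ * a) * pg - 2 * ((1 - a) * γ * γ') * pz + 2 * (a * γ') * zg)) ≤
      (1 - a) * (fx - fb + γ / 2 * (P - 2 * pz + Z)) := by
  have hq : qg = - (a * γ * pg) / γ' := by
    field_simp
    linarith
  have hPbound : ((1 - a) * γ) ^ 2 * P / (2 * γ') ≤ (1 - a) * γ * P / 2 := by
    rw [div_le_div_iff₀ (by positivity) two_pos]
    have h5 : 0 ≤ (1 - a) * γ * P := by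
      have : 0 ≤ 1 - a := by linarith
      positivity
    have h6 : (1 - a) * γ ≤ γ' := by
      rw [hγ']
      linarith
    nlinarith [mul_le_mul_of_nonneg_left h6 h5]
  have hsplit : γ' / 2 * (γ'⁻¹ ^ 2 * (((1 - a) * γ) ^ 2 * P + a ^ 2 * Q + γ' ^ 2 * Z
        - 2 * ((1 - a) * γ * a) * pg - 2 * ((1 - a) * γ * γ') * pz + 2 * (a * γ') * zg)) =
      ((1 - a) * γ) ^ 2 * P / (2 * γ') + a ^ 2 / γ' * Q / 2 + γ' * Z / 2 + (1 - a) * qg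
        - (1 - a) * γ * pz + a * zg := by
    rw [hq]
    field_simp
    ring
  -- The equation defining `a` makes the `‖g‖²` produced by the update of `v` cancel exactly against
  -- the decrease `‖g‖² / (2ℓ)` of `f`.
  have haγ : a ^ 2 / γ' = ℓ⁻¹ := by
    rw [← haeq]
    field_simp
  have hupe : fx' ≤ fy - ℓ⁻¹ * Q / 2 := by
    have : ℓ / 2 * (ℓ⁻¹ ^ 2 * Q) = ℓ⁻¹ * Q / 2 := by field_simp
    linarith
  rw [hsplit, haγ]
  -- The lower bounds of `f` at `x` and at `b` are combined with weights `1 - a` and `a`.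
  have k1 : 0 ≤ (1 - a) * (fx - fy - qg) := mul_nonneg (by linarith) (by linarith)
  have k2 : 0 ≤ a * (fb - fy - zg - μ / 2 * Z) := mul_nonneg ha.le (by linarith)
  have k3 : γ' * Z / 2 = (1 - a) * γ * Z / 2 + a * μ * Z / 2 := by rw [hγ']; ring
  nlinarith

/-- The energy contracted by accelerated gradient descent. -/
def AGDState.energy (f : EuclideanSpace ℝ (Fin d) → ℝ) (b : EuclideanSpace ℝ (Fin d))
    (s : AGDState d) : ℝ :=
  f s.x - f b + s.γ / 2 * ‖s.v - b‖ ^ 2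

theorem energy_agdStep_le {f : EuclideanSpace ℝ (Fin d) → ℝ} (h : IsRegularLoss f μ ℓ)
    (hμ : 0 < μ) (hμℓ : μ ≤ ℓ) (b : EuclideanSpace ℝ (Fin d)) {s : AGDState d} (hs : 0 < s.γ) :
    (agdStep μ ℓ (∇ f) s).energy f b ≤ (1 - agdWeight μ ℓ s.γ) * s.energy f b := by
  have hℓ : 0 < ℓ := hμ.trans_le hμℓ
  have ha := agdWeight_pos (μ := μ) hℓ hs
  have ha1 := agdWeight_le_one hℓ hs hμℓ
  have haeq := agdWeight_eq (μ := μ) hℓ hs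
  obtain ⟨x, v, γ⟩ := s
  simp only [agdStep, AGDState.energy] at *
  set a := agdWeight μ ℓ γ with hadef
  set γ' := (1 - a) * γ + a * μ with hγ'
  have hγ'pos : 0 < γ' := by rw [← haeq]; positivity
  have hden : 0 < γ + a * μ := by positivity
  set y := (γ + a * μ)⁻¹ • ((a * γ) • v + γ' • x) with hy
  set g := ∇ f y with hg
  have hbal : (a * γ) • (v - y) + γ' • (x - y) = 0 := by
    have h1 : (γ + a * μ) • y = (a * γ) • v + γ' • x := by
      rw [hy, smul_inv_smul₀ hden.ne']
    have h2 : (γ + a * μ) • y = (a * γ) • y + γ' • y := by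
      rw [← add_smul]
      congr 1
      rw [hγ']
      ring
    rw [smul_sub, smul_sub, sub_add_sub_comm, ← h1, ← h2, sub_self]
  have hvb : γ'⁻¹ • (((1 - a) * γ) • v + (a * μ) • y - a • g) - b =
      γ'⁻¹ • (((1 - a) * γ) • (v - y) - a • g - γ' • (b - y)) := by
    have h3 : ((1 - a) * γ) • v + (a * μ) • y =
        ((1 - a) * γ) • (v - y) + γ' • y := by
      rw [hγ', smul_sub, add_smul]
      abel
    have h4 : b = γ'⁻¹ • γ' • b := (inv_smul_smul₀ hγ'pos.ne' b).symm
    nth_rewrite 1 [h3, h4]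
    rw [← smul_sub, smul_sub γ' b y]
    congr 1
    abel
  have hvv : v - b = (v - y) - (b - y) := by abel
  have hup := h.upper_bound y (y - ℓ⁻¹ • g)
  rw [← hg, sub_sub_cancel_left, inner_neg_right, real_inner_smul_right,
    real_inner_self_eq_norm_sq, norm_neg, norm_smul, Real.norm_of_nonneg (by positivity),
    mul_pow] at hup
  have hlb := h.lower_bound y b
  have hlx := h.lower_bound y x
  rw [← hg] at hlb hlx
  have hlx' : 0 ≤ μ / 2 * ‖x - y‖ ^ 2 := by positivity
  have hbal' := congrArg (fun w => inner ℝ g w) hbal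
  simp only [inner_add_right, real_inner_smul_right, inner_zero_right] at hbal'
  rw [hvb, hvv, norm_smul, mul_pow, Real.norm_of_nonneg (by positivity : 0 ≤ γ'⁻¹)]
  have hexp : ‖((1 - a) * γ) • (v - y) - a • g - γ' • (b - y)‖ ^ 2 =
      ((1 - a) * γ) ^ 2 * ‖v - y‖ ^ 2 + a ^ 2 * ‖g‖ ^ 2 + γ' ^ 2 * ‖b - y‖ ^ 2
        - 2 * ((1 - a) * γ * a) * inner ℝ g (v - y)
        - 2 * ((1 - a) * γ * γ') * inner ℝ (v - y) (b - y)
        + 2 * (a * γ') * inner ℝ g (b - y) := by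
    rw [norm_sub_sq_real, norm_sub_sq_real, inner_sub_left]
    simp only [real_inner_smul_left, real_inner_smul_right, norm_smul, mul_pow, Real.norm_eq_abs,
      sq_abs, real_inner_comm g (v - y)]
    ring
  have hnv : ‖v - y - (b - y)‖ ^ 2 =
      ‖v - y‖ ^ 2 - 2 * inner ℝ (v - y) (b - y) + ‖b - y‖ ^ 2 := norm_sub_sq_real _ _
  rw [hexp, hnv]
  have hP : 0 ≤ ‖v - y‖ ^ 2 := by positivity
  exact energy_scalar_inequality hℓ ha ha1 hs hγ' hγ'pos haeq hP hbal' hup (by linarith) hlb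
    (by positivity)

/-- The state of accelerated gradient descent after `k` steps. -/
def agdState (μ ℓ : ℝ) (G : EuclideanSpace ℝ (Fin d) → EuclideanSpace ℝ (Fin d))
    (x₀ : EuclideanSpace ℝ (Fin d)) (k : ℕ) : AGDState d :=
  (agdStep μ ℓ G)^[k] { x := x₀, v := x₀, γ := ℓ }

/-- The accumulated contraction factor of accelerated gradient descent after `k` steps. -/
def agdFactor (μ ℓ : ℝ) (G : EuclideanSpace ℝ (Fin d) → EuclideanSpace ℝ (Fin d))
    (x₀ : EuclideanSpace ℝ (Fin d)) (k : ℕ) : ℝ :=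
  ∏ i ∈ Finset.range k, (1 - agdWeight μ ℓ (agdState μ ℓ G x₀ i).γ)

variable {G : EuclideanSpace ℝ (Fin d) → EuclideanSpace ℝ (Fin d)}
  {x₀ : EuclideanSpace ℝ (Fin d)}

theorem agdState_succ (k : ℕ) :
    agdState μ ℓ G x₀ (k + 1) = agdStep μ ℓ G (agdState μ ℓ G x₀ k) :=
  Function.iterate_succ_apply' _ _ _

theorem agdFactor_succ (k : ℕ) : agdFactor μ ℓ G x₀ (k + 1) =
    agdFactor μ ℓ G x₀ k * (1 - agdWeight μ ℓ (agdState μ ℓ G x₀ k).γ) :=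
  Finset.prod_range_succ _ _

/-- The recursion for `γ` is affine with fixed point `μ`, so `γ - μ` contracts by the same factors
`1 - a` as the energy. This ties the weights to the accumulated factor. -/
theorem agdState_γ_eq (hμ : 0 < μ) (hμℓ : μ ≤ ℓ) (k : ℕ) : 0 ≤ agdFactor μ ℓ G x₀ k ∧
    (agdState μ ℓ G x₀ k).γ = μ + agdFactor μ ℓ G x₀ k * (ℓ - μ) := by
  induction k with
  | zero => simp [agdFactor, agdState]
  | succ k ih =>
    have hpos : 0 < (agdState μ ℓ G x₀ k).γ := by
      rw [ih.2]
      have := mul_nonneg ih.1 (sub_nonneg.2 hμℓ)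
      linarith
    constructor
    · rw [agdFactor_succ]
      exact mul_nonneg ih.1 (sub_nonneg.2 (agdWeight_le_one (hμ.trans_le hμℓ) hpos hμℓ))
    · rw [agdFactor_succ, agdState_succ]
      simp only [agdStep]
      generalize agdWeight μ ℓ (agdState μ ℓ G x₀ k).γ = a
      rw [ih.2]
      ring

theorem modulus_le_agdState_γ (hμ : 0 < μ) (hμℓ : μ ≤ ℓ) (k : ℕ) :
    μ ≤ (agdState μ ℓ G x₀ k).γ := by
  have h1 := agdState_γ_eq (G := G) (x₀ := x₀) hμ hμℓ k
  have := mul_nonneg h1.1 (sub_nonneg.2 hμℓ)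
  linarith [h1.2]

theorem mul_agdWeight_sq (hμ : 0 < μ) (hμℓ : μ ≤ ℓ) (k : ℕ) :
    ℓ * agdWeight μ ℓ (agdState μ ℓ G x₀ k).γ ^ 2 = (agdState μ ℓ G x₀ (k + 1)).γ := by
  rw [agdWeight_eq (hμ.trans_le hμℓ) (hμ.trans_le (modulus_le_agdState_γ hμ hμℓ k)),
    agdState_succ]
  rfl

theorem energy_agdState_le {f : EuclideanSpace ℝ (Fin d) → ℝ} (h : IsRegularLoss f μ ℓ)
    (hμ : 0 < μ) (hμℓ : μ ≤ ℓ) (b : EuclideanSpace ℝ (Fin d)) (k : ℕ) :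
    (agdState μ ℓ (∇ f) x₀ k).energy f b ≤
      agdFactor μ ℓ (∇ f) x₀ k * (f x₀ - f b + ℓ / 2 * ‖x₀ - b‖ ^ 2) := by
  induction k with
  | zero => simp [agdFactor, agdState, AGDState.energy]
  | succ k ih =>
    have hpos := hμ.trans_le (modulus_le_agdState_γ (G := ∇ f) (x₀ := x₀) hμ hμℓ k)
    have h1 := agdWeight_le_one (hμ.trans_le hμℓ) hpos hμℓ
    rw [agdState_succ, agdFactor_succ]
    refine (energy_agdStep_le h hμ hμℓ b hpos).trans ?_
    refine (mul_le_mul_of_nonneg_left ih (sub_nonneg.2 h1)).trans (le_of_eq ?_)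
    ring

theorem agdFactor_le_one (hμ : 0 < μ) (hμℓ : μ ≤ ℓ) (k : ℕ) : agdFactor μ ℓ G x₀ k ≤ 1 := by
  induction k with
  | zero => simp [agdFactor]
  | succ k ih =>
    have hpos := hμ.trans_le (modulus_le_agdState_γ (G := G) (x₀ := x₀) hμ hμℓ k)
    have h1 := agdWeight_pos (μ := μ) (hμ.trans_le hμℓ) hpos
    have h2 := (agdState_γ_eq (G := G) (x₀ := x₀) hμ hμℓ k).1
    rw [agdFactor_succ]
    nlinarith

/-- With `Λ` the accumulated factor, `ℓ a_k² = γ_{k+1} = μ + Λ_{k+1}(ℓ - μ) ≥ ℓ Λ_{k+1}` because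
`Λ_{k+1} ≤ 1`. -/
theorem sqrt_agdFactor_le_agdWeight (hμ : 0 < μ) (hμℓ : μ ≤ ℓ) (k : ℕ) :
    Real.sqrt (agdFactor μ ℓ G x₀ (k + 1)) ≤ agdWeight μ ℓ (agdState μ ℓ G x₀ k).γ := by
  have hℓ := hμ.trans_le hμℓ
  have hpos := hμ.trans_le (modulus_le_agdState_γ (G := G) (x₀ := x₀) hμ hμℓ k)
  rw [Real.sqrt_le_left (agdWeight_pos hℓ hpos).le]
  refine le_of_mul_le_mul_left ?_ hℓ
  rw [mul_agdWeight_sq hμ hμℓ, (agdState_γ_eq hμ hμℓ (k + 1)).2]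
  have := agdFactor_le_one (G := G) (x₀ := x₀) hμ hμℓ (k + 1)
  nlinarith

theorem inv_sqrt_le_agdWeight (hμ : 0 < μ) (hμℓ : μ ≤ ℓ) (k : ℕ) :
    (Real.sqrt (ℓ / μ))⁻¹ ≤ agdWeight μ ℓ (agdState μ ℓ G x₀ k).γ := by
  have hℓ := hμ.trans_le hμℓ
  have hpos := hμ.trans_le (modulus_le_agdState_γ (G := G) (x₀ := x₀) hμ hμℓ k)
  rw [← Real.sqrt_inv, inv_div, Real.sqrt_le_left (agdWeight_pos hℓ hpos).le, div_le_iff₀ hℓ,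
    mul_comm, mul_agdWeight_sq hμ hμℓ]
  exact modulus_le_agdState_γ hμ hμℓ _

/-- The sublinear rate, from `Λ_{k+1} = Λ_k (1 - a_k) ≤ Λ_k (1 - √Λ_{k+1})`. It is needed besides
the linear rate to gain a factor `κ` in `O(√κ)` steps instead of `O(√κ log κ)`. -/
theorem sqrt_agdFactor_le (hμ : 0 < μ) (hμℓ : μ ≤ ℓ) (k : ℕ) :
    Real.sqrt (agdFactor μ ℓ G x₀ k) ≤ 2 / (k + 2) := by
  induction k with
  | zero => simp [agdFactor]
  | succ k ih =>
    have h0 := (agdState_γ_eq (G := G) (x₀ := x₀) hμ hμℓ k).1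
    have h0' := (agdState_γ_eq (G := G) (x₀ := x₀) hμ hμℓ (k + 1)).1
    have hsq := Real.sq_sqrt h0
    have hsq' := Real.sq_sqrt h0'
    have hw := sqrt_agdFactor_le_agdWeight (G := G) (x₀ := x₀) hμ hμℓ k
    have hs0 := Real.sqrt_nonneg (agdFactor μ ℓ G x₀ k)
    have hle : Real.sqrt (agdFactor μ ℓ G x₀ (k + 1)) ^ 2 ≤
        Real.sqrt (agdFactor μ ℓ G x₀ k) ^ 2 * (1 - Real.sqrt (agdFactor μ ℓ G x₀ (k + 1))) := by
      rw [hsq', hsq]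
      nth_rewrite 1 [agdFactor_succ]
      exact mul_le_mul_of_nonneg_left (by linarith) h0
    have hs' : Real.sqrt (agdFactor μ ℓ G x₀ (k + 1)) ≤ 1 :=
      Real.sqrt_le_one.2 (agdFactor_le_one hμ hμℓ (k + 1))
    generalize Real.sqrt (agdFactor μ ℓ G x₀ k) = s at *
    generalize Real.sqrt (agdFactor μ ℓ G x₀ (k + 1)) = s' at *
    push_cast
    by_contra hc
    push Not at hc
    have hk : (0 : ℝ) ≤ k := k.cast_nonneg
    have e1 : s ^ 2 ≤ (2 / (k + 2)) ^ 2 := pow_le_pow_left₀ hs0 ih 2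
    have e2 : s' ^ 2 ≤ (2 / ((k : ℝ) + 2)) ^ 2 * (1 - 2 / (k + 1 + 2)) := by
      refine hle.trans ?_
      exact (mul_le_mul_of_nonneg_right e1 (by linarith)).trans
        (mul_le_mul_of_nonneg_left (by linarith) (by positivity))
    have e3 : (2 / ((k : ℝ) + 1 + 2)) ^ 2 < s' ^ 2 :=
      pow_lt_pow_left₀ hc (by positivity) two_ne_zero
    have e4 : (2 / ((k : ℝ) + 2)) ^ 2 * (1 - 2 / (k + 1 + 2)) ≤ (2 / ((k : ℝ) + 1 + 2)) ^ 2 := by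
      have : (2 / ((k : ℝ) + 1 + 2)) ^ 2 - (2 / ((k : ℝ) + 2)) ^ 2 * (1 - 2 / (k + 1 + 2)) =
          4 / ((k + 2) ^ 2 * (k + 3) ^ 2) := by
        field_simp
        ring
      have h4 : (0 : ℝ) ≤ 4 / (((k : ℝ) + 2) ^ 2 * (k + 3) ^ 2) := by positivity
      linarith
    linarith

theorem agdFactor_add_le (hμ : 0 < μ) (hμℓ : μ ≤ ℓ) (k j : ℕ) :
    agdFactor μ ℓ G x₀ (k + j) ≤
      agdFactor μ ℓ G x₀ k * Real.exp (-(j / Real.sqrt (ℓ / μ))) := by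
  induction j with
  | zero => simp
  | succ j ih =>
    have hw := inv_sqrt_le_agdWeight (G := G) (x₀ := x₀) hμ hμℓ (k + j)
    have h0 := (agdState_γ_eq (G := G) (x₀ := x₀) hμ hμℓ (k + j)).1
    rw [← add_assoc, agdFactor_succ]
    have h1 : 1 - agdWeight μ ℓ (agdState μ ℓ G x₀ (k + j)).γ ≤
        Real.exp (-(Real.sqrt (ℓ / μ))⁻¹) := by
      have := Real.add_one_le_exp (-(Real.sqrt (ℓ / μ))⁻¹)
      linarith
    refine (mul_le_mul_of_nonneg_left h1 h0).trans
      ((mul_le_mul_of_nonneg_right ih (Real.exp_pos _).le).trans (le_of_eq ?_))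
    rw [mul_assoc, ← Real.exp_add]
    congr 2
    push_cast
    ring

theorem agd_dist_sq_le {f : EuclideanSpace ℝ (Fin d) → ℝ} (h : IsRegularLoss f μ ℓ)
    (hμ : 0 < μ) (hμℓ : μ ≤ ℓ) {b : EuclideanSpace ℝ (Fin d)} (hb : IsMinOn f Set.univ b)
    (k : ℕ) :
    ‖agd μ ℓ (∇ f) x₀ k - b‖ ^ 2 ≤
      2 * (ℓ / μ) * agdFactor μ ℓ (∇ f) x₀ k * ‖x₀ - b‖ ^ 2 := by
  have h1 := energy_agdState_le (x₀ := x₀) h hμ hμℓ b k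
  have h2 := h.quadratic_growth hb (agd μ ℓ (∇ f) x₀ k)
  have h3 := h.upper_bound b x₀
  rw [h.gradient_eq_zero hb, inner_zero_left] at h3
  have h4 := (agdState_γ_eq (G := ∇ f) (x₀ := x₀) hμ hμℓ k).1
  have hpos := hμ.trans_le (modulus_le_agdState_γ (G := ∇ f) (x₀ := x₀) hμ hμℓ k)
  have h5 : f (agd μ ℓ (∇ f) x₀ k) - f b ≤
      agdFactor μ ℓ (∇ f) x₀ k * (ℓ * ‖x₀ - b‖ ^ 2) := by
    have h6 : 0 ≤ (agdState μ ℓ (∇ f) x₀ k).γ / 2 * ‖(agdState μ ℓ (∇ f) x₀ k).v - b‖ ^ 2 := by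
      positivity
    have h7 : f (agd μ ℓ (∇ f) x₀ k) - f b ≤ (agdState μ ℓ (∇ f) x₀ k).energy f b := by
      unfold AGDState.energy
      exact le_add_of_nonneg_right h6
    exact h7.trans (h1.trans (mul_le_mul_of_nonneg_left (by linarith) h4))
  refine le_of_mul_le_mul_left ((h2.trans h5).trans (le_of_eq ?_)) (half_pos hμ)
  field_simp

/-- Two phases: `⌈2√κ⌉` steps at the sublinear rate cancel the factor `κ` of `agd_dist_sq_le`, then
the linear rate does the rest. -/
theorem exists_agd_dist_le {f : EuclideanSpace ℝ (Fin d) → ℝ} (h : IsRegularLoss f μ ℓ)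
    (hμ : 0 < μ) (hμℓ : μ ≤ ℓ) {b : EuclideanSpace ℝ (Fin d)} (hb : IsMinOn f Set.univ b)
    (x₀ : EuclideanSpace ℝ (Fin d)) {r : ℝ} (hr : 0 < r) :
    ∃ k : ℕ, ‖agd μ ℓ (∇ f) x₀ k - b‖ ≤ r ∧
      (k : ℝ) ≤ 10 * (Real.sqrt (ℓ / μ) * Real.log (1 + ‖x₀ - b‖ / r)) := by
  have hκ : 1 ≤ ℓ / μ := (one_le_div hμ).2 hμℓ
  have hs : 1 ≤ Real.sqrt (ℓ / μ) := Real.one_le_sqrt.2 hκ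
  have hssq : Real.sqrt (ℓ / μ) ^ 2 = ℓ / μ := Real.sq_sqrt (by linarith)
  rcases le_or_gt ‖x₀ - b‖ r with hle | hlt
  · refine ⟨0, hle, ?_⟩
    have : 0 ≤ Real.log (1 + ‖x₀ - b‖ / r) :=
      Real.log_nonneg (by have : 0 ≤ ‖x₀ - b‖ / r := by positivity
                          linarith)
    simpa using mul_nonneg (Real.sqrt_nonneg (ℓ / μ)) this
  · set s := Real.sqrt (ℓ / μ) with hsdef
    set q := ‖x₀ - b‖ / r with hq
    have hq1 : 1 < q := (one_lt_div hr).2 hlt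
    set k := ⌈2 * s⌉₊
    -- The summand `1` yields a factor `e ≥ 2`, which absorbs the `2` of `agd_dist_sq_le`.
    set j := ⌈s * (1 + 2 * Real.log q)⌉₊
    have hlogq : 0 < Real.log q := Real.log_pos hq1
    refine ⟨k + j, ?_, ?_⟩
    · refine (pow_le_pow_iff_left₀ (norm_nonneg _) hr.le two_ne_zero).1 ?_
      refine (agd_dist_sq_le h hμ hμℓ hb (k + j)).trans ?_
      have h0 := (agdState_γ_eq (G := ∇ f) (x₀ := x₀) hμ hμℓ k).1
      have h1 : agdFactor μ ℓ (∇ f) x₀ k ≤ (s⁻¹) ^ 2 := by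
        rw [← Real.sq_sqrt h0]
        refine pow_le_pow_left₀ (Real.sqrt_nonneg _) ?_ 2
        refine (sqrt_agdFactor_le hμ hμℓ k).trans ?_
        rw [div_le_iff₀ (by positivity)]
        have h3 : 2 * s ≤ k := Nat.le_ceil _
        have h4 : s⁻¹ * (2 * s) = 2 := by field_simp
        have h5 : s⁻¹ * (2 * s) ≤ s⁻¹ * (k + 2) :=
          mul_le_mul_of_nonneg_left (by linarith) (by positivity)
        linarith
      have h2 : Real.exp (-(j / s)) ≤ (2 * q ^ 2)⁻¹ := by
        have h3 : s * (1 + 2 * Real.log q) ≤ j := Nat.le_ceil _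
        have h4 : 1 + 2 * Real.log q ≤ j / s := by
          rw [le_div_iff₀ (by positivity)]
          linarith
        have h5 : (2 : ℝ) * q ^ 2 ≤ Real.exp (1 + 2 * Real.log q) := by
          rw [Real.exp_add, mul_comm 2 (Real.log q), Real.exp_mul, Real.exp_log (by linarith)]
          have := Real.add_one_le_exp 1
          norm_cast
          gcongr
          linarith
        rw [Real.exp_neg]
        exact inv_anti₀ (by positivity) (h5.trans (Real.exp_le_exp.2 h4))
      have h3 := agdFactor_add_le (G := ∇ f) (x₀ := x₀) hμ hμℓ k j
      have h4 : agdFactor μ ℓ (∇ f) x₀ (k + j) ≤ s⁻¹ ^ 2 * (2 * q ^ 2)⁻¹ :=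
        h3.trans (mul_le_mul h1 h2 (Real.exp_pos _).le (by positivity))
      have h5 : ‖x₀ - b‖ = q * r := by rw [hq]; field_simp
      rw [h5, ← hssq]
      calc 2 * s ^ 2 * agdFactor μ ℓ (∇ f) x₀ (k + j) * (q * r) ^ 2
          ≤ 2 * s ^ 2 * (s⁻¹ ^ 2 * (2 * q ^ 2)⁻¹) * (q * r) ^ 2 := by gcongr
        _ = r ^ 2 := by field_simp
    · have h1 : (k : ℝ) < 2 * s + 1 := Nat.ceil_lt_add_one (by positivity)
      have h2 : (j : ℝ) < s * (1 + 2 * Real.log q) + 1 := Nat.ceil_lt_add_one (by positivity)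
      have h3 : Real.log q ≤ Real.log (1 + q) := Real.log_le_log (by linarith) (by linarith)
      -- As `log(1 + q) > log 2`, the terms of `k + j` free of `log q`, at most `5 s`, are absorbed
      -- into the constant `10`.
      have h4 : 0.6931471803 < Real.log (1 + q) :=
        Real.log_two_gt_d9.trans_le (Real.log_le_log two_pos (by linarith))
      push_cast
      nlinarith

end AGD

/-! ### Termination and cost of one inner run. -/

section InnerSolver

variable {m d : ℕ} {f : EuclideanSpace ℝ (Fin d) → ℝ} {μ ℓ : ℝ} {D : Matrix (Fin m) (Fin d) ℝ}

theorem innerSolve_isApproxMinimizer (h : IsRegularLoss f μ ℓ) (hμ : 0 < μ) (hμℓ : μ ≤ ℓ)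
    (α : EuclideanSpace ℝ (Fin m)) (x₀ : EuclideanSpace ℝ (Fin d)) {r : ℝ} (hr : 0 < r) :
    IsApproxMinimizer (lagrangian f D α) r (innerSolve f D μ ℓ r α x₀) := by
  obtain ⟨b, hb⟩ := (h.lagrangian (D := D) α).exists_isMinOn hμ
  obtain ⟨k, hk, -⟩ := exists_agd_dist_le (h.lagrangian (D := D) α) hμ hμℓ hb x₀ hr
  rw [gradient_lagrangian h] at hk
  -- An infimum over an empty set of naturals would be `0`, so a witness `k` is essential.
  have : innerCalls f D μ ℓ r α x₀ ∈ {k : ℕ | IsApproxMinimizer (lagrangian f D α) r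
      (agd μ ℓ (lagrangianGrad f D α) x₀ k)} := Nat.sInf_mem ⟨k, b, hb, hk⟩
  exact this

theorem innerCalls_le (h : IsRegularLoss f μ ℓ) (hμ : 0 < μ) (hμℓ : μ ≤ ℓ)
    {α : EuclideanSpace ℝ (Fin m)} (x₀ : EuclideanSpace ℝ (Fin d)) {r : ℝ} (hr : 0 < r)
    {b : EuclideanSpace ℝ (Fin d)} (hb : IsMinOn (lagrangian f D α) Set.univ b) :
    (innerCalls f D μ ℓ r α x₀ : ℝ) ≤
      10 * (Real.sqrt (ℓ / μ) * Real.log (1 + ‖x₀ - b‖ / r)) := by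
  obtain ⟨k, hk, hk'⟩ := exists_agd_dist_le (h.lagrangian (D := D) α) hμ hμℓ hb x₀ hr
  rw [gradient_lagrangian h] at hk
  refine le_trans ?_ hk'
  exact Nat.cast_le.2 (Nat.sInf_le ⟨b, hb, hk⟩)

end InnerSolver

/-! ### The largest eigenvalue of `D Dᵀ`. -/

section Sigma

variable {m d : ℕ} (D : Matrix (Fin m) (Fin d) ℝ)

/-- The Rayleigh quotient of `D Dᵀ` at `α` is `‖Dᵀ α‖² / ‖α‖²`; its supremum is an eigenvalue. -/
theorem norm_transpose_sq_le (α : EuclideanSpace ℝ (Fin m)) :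
    ‖D.transpose.toEuclideanLin α‖ ^ 2 ≤ sigmaMax D * ‖α‖ ^ 2 := by
  rcases eq_or_ne α 0 with rfl | hα
  · simp
  have : Nontrivial (EuclideanSpace ℝ (Fin m)) := ⟨α, 0, hα⟩
  set T := (D * D.transpose).toEuclideanLin with hT
  have hTapply : ∀ x, T x = D.toEuclideanLin (D.transpose.toEuclideanLin x) := by
    intro x
    simp [hT, Matrix.toLpLin_apply, Matrix.mulVec_mulVec]
  have hTinner : ∀ x y, inner ℝ (T x) y =
      inner ℝ (D.transpose.toEuclideanLin x) (D.transpose.toEuclideanLin y) := by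
    intro x y
    rw [hTapply, real_inner_comm, inner_toEuclideanLin, real_inner_comm]
  have hsymm : T.IsSymmetric := by
    intro x y
    rw [hTinner, real_inner_comm, ← hTinner, real_inner_comm]
  have hev := hsymm.hasEigenvalue_iSup_of_finiteDimensional
  have hmem := hev.mem_spectrum
  rw [hT, Matrix.spectrum_toLpLin] at hmem
  have hfin : (spectrum ℝ (D * D.transpose)).Finite :=
    Matrix.finite_spectrum _
  have hle := le_csSup hfin.bddAbove hmem
  have hbdd : BddAbove (Set.range fun x : {x : EuclideanSpace ℝ (Fin m) // x ≠ 0} =>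
      RCLike.re (inner ℝ (T x) (x : EuclideanSpace ℝ (Fin m))) /
        ‖(x : EuclideanSpace ℝ (Fin m))‖ ^ 2) := by
    refine ⟨‖T.toContinuousLinearMap‖, ?_⟩
    rintro _ ⟨⟨x, hx⟩, rfl⟩
    have hx' : 0 < ‖x‖ := norm_pos_iff.2 hx
    rw [div_le_iff₀ (by positivity)]
    have h1 := real_inner_le_norm (T x) x
    have h2 := T.toContinuousLinearMap.le_opNorm x
    rw [LinearMap.coe_toContinuousLinearMap'] at h2
    simp only [RCLike.re_to_real]
    nlinarith
  have h3 := (le_ciSup hbdd ⟨α, hα⟩).trans hle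
  simp only [RCLike.re_to_real] at h3
  rw [hTinner, real_inner_self_eq_norm_sq, div_le_iff₀ (by positivity)] at h3
  exact h3

theorem norm_row_sq_le (j : Fin m) :
    ‖(WithLp.toLp 2 (D j) : EuclideanSpace ℝ (Fin d))‖ ^ 2 ≤ sigmaMax D := by
  have h := norm_transpose_sq_le D (EuclideanSpace.single j 1)
  have h1 : D.transpose.toEuclideanLin (EuclideanSpace.single j 1) = WithLp.toLp 2 (D j) := by
    ext i
    simp [Matrix.toLpLin_apply]
  rw [h1] at h
  simpa using h

variable {D}

theorem exists_row_ne_zero (hD : D ≠ 0) :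
    ∃ j, (WithLp.toLp 2 (D j) : EuclideanSpace ℝ (Fin d)) ≠ 0 := by
  by_contra hc
  push Not at hc
  apply hD
  ext j i
  simpa using congrFun (congrArg WithLp.ofLp (hc j)) i

theorem sigmaMax_pos (hD : D ≠ 0) : 0 < sigmaMax D := by
  obtain ⟨j, hj⟩ := exists_row_ne_zero hD
  have := norm_pos_iff.2 hj
  exact lt_of_lt_of_le (by positivity) (norm_row_sq_le D j)

theorem transpose_eq_sum (α : EuclideanSpace ℝ (Fin m)) :
    D.transpose.toEuclideanLin α = ∑ j, α j • (WithLp.toLp 2 (D j) : EuclideanSpace ℝ (Fin d)) := by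
  ext i
  simp [Matrix.toLpLin_apply, Matrix.mulVec, dotProduct, mul_comm]

end Sigma

/-! ### The constant `θ(D)` and conformal decompositions. -/

section Theta

variable {m d : ℕ} (D : Matrix (Fin m) (Fin d) ℝ)

/-- On the vectors supported in `S` the map `c ↦ ∑ c k • w k` is injective, hence bounded below in
finite dimension. -/
theorem exists_norm_le_of_linearIndependent {ι E : Type*} [Fintype ι] [DecidableEq ι]
    [NormedAddCommGroup E]
    [NormedSpace ℝ E] (w : ι → E) (S : Set ι)
    (hS : LinearIndependent ℝ (fun k : S => w k)) :
    ∃ K : ℝ, 0 ≤ K ∧ ∀ c : EuclideanSpace ℝ ι, {k | c k ≠ 0} = S → ‖c‖ ≤ K * ‖∑ k, c k • w k‖ := by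
  classical
  let V : Submodule ℝ (EuclideanSpace ℝ ι) :=
    { carrier := {c | ∀ k ∉ S, c k = 0}
      add_mem' := fun ha hb k hk => by simp [ha k hk, hb k hk]
      zero_mem' := fun k _ => rfl
      smul_mem' := fun r a ha k hk => by simp [ha k hk] }
  let F : EuclideanSpace ℝ ι →ₗ[ℝ] E :=
    { toFun := fun c => ∑ k, c k • w k
      map_add' := fun a b => by simp [add_smul, Finset.sum_add_distrib]
      map_smul' := fun r a => by simp [Finset.smul_sum, mul_smul] }
  have hker : LinearMap.ker (F ∘ₗ V.subtype) = ⊥ := by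
    rw [LinearMap.ker_eq_bot']
    rintro ⟨c, hc⟩ h0
    have h1 : ∑ k, c k • w k = 0 := h0
    have h2 : ∑ k : S, c k • w k = 0 := by
      rw [← h1]
      exact Fintype.sum_of_injective Subtype.val Subtype.val_injective _ _
        (fun k hk => by simp [hc k (by simpa using hk)]) fun _ => rfl
    rw [Fintype.linearIndependent_iff] at hS
    have h3 := hS (fun k => c k) h2
    apply Subtype.ext
    ext k
    by_cases hk : k ∈ S
    · exact h3 ⟨k, hk⟩
    · exact hc k hk
  obtain ⟨K, -, hK⟩ := (F ∘ₗ V.subtype).exists_antilipschitzWith hker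
  refine ⟨K, K.2, fun c hc => ?_⟩
  have h := hK.le_mul_dist ⟨c, fun k hk => by
    rw [← hc] at hk
    simpa using hk⟩ 0
  rw [map_zero, dist_zero_right, dist_zero_right] at h
  exact h

/-- There are finitely many supports, each with its own bound. This makes the `sSup` in `theta` a
true supremum, not the default value `0`. -/
theorem theta_bddAbove :
    BddAbove {r : ℝ | ∃ c : EuclideanSpace ℝ (Fin d ⊕ Fin d ⊕ Fin m),
      (∀ i : Fin d, 0 ≤ c (Sum.inl i)) ∧ (∀ i : Fin d, 0 ≤ c (Sum.inr (Sum.inl i))) ∧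
      ‖∑ k, c k • blockColumn D k‖ = 1 ∧
      LinearIndependent ℝ (fun k : {k // c k ≠ 0} => blockColumn D k.1) ∧
      r = ‖c‖} := by
  classical
  have h : ∀ S : Set (Fin d ⊕ Fin d ⊕ Fin m), ∃ K : ℝ, 0 ≤ K ∧
      (LinearIndependent ℝ (fun k : S => blockColumn D k) →
      ∀ c : EuclideanSpace ℝ (Fin d ⊕ Fin d ⊕ Fin m), {k | c k ≠ 0} = S →
        ‖c‖ ≤ K * ‖∑ k, c k • blockColumn D k‖) := by
    intro S
    by_cases hS : LinearIndependent ℝ (fun k : S => blockColumn D k)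
    · obtain ⟨K, hK, h⟩ := exists_norm_le_of_linearIndependent _ S hS
      exact ⟨K, hK, fun _ => h⟩
    · exact ⟨0, le_rfl, fun h => absurd h hS⟩
  choose K hK0 hK using h
  refine ⟨∑ S, K S, ?_⟩
  rintro r ⟨c, -, -, h1, hli, rfl⟩
  have h2 := hK {k | c k ≠ 0} hli c rfl
  rw [h1, mul_one] at h2
  exact h2.trans (Finset.single_le_sum (fun S _ => hK0 S) (Finset.mem_univ _))

/-- A vector supported on linearly independent rows of `D` is controlled by `θ(D)`. -/
theorem norm_le_theta_mul (v : EuclideanSpace ℝ (Fin m))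
    (hv : LinearIndependent ℝ (fun j : {j // v j ≠ 0} =>
      (WithLp.toLp 2 (D j) : EuclideanSpace ℝ (Fin d)))) :
    ‖v‖ ≤ theta D * ‖D.transpose.toEuclideanLin v‖ := by
  rcases eq_or_ne (D.transpose.toEuclideanLin v) 0 with h0 | h0
  · have hv0 : v = 0 := by
      classical
      rw [transpose_eq_sum] at h0
      rw [Fintype.linearIndependent_iff] at hv
      ext j
      by_contra hj
      refine hj (hv (fun j => v j) ?_ ⟨j, hj⟩)
      rw [← h0]
      exact Fintype.sum_of_injective Subtype.val Subtype.val_injective _ _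
        (fun k hk => by
          have : v k = 0 := by simpa using hk
          simp [this]) fun _ => rfl
    simp [hv0]
  · set n := ‖D.transpose.toEuclideanLin v‖ with hn
    have hnpos : 0 < n := norm_pos_iff.2 h0
    -- Only the free block is used: `u₁ = u₂ = 0`, with `v` scaled so that its image has norm one.
    let c : EuclideanSpace ℝ (Fin d ⊕ Fin d ⊕ Fin m) :=
      WithLp.toLp 2 (Sum.elim 0 (Sum.elim 0 (fun j => n⁻¹ * v j)))
    have hnorm : ‖c‖ = n⁻¹ * ‖v‖ := by
      have : ‖c‖ = ‖n⁻¹ • v‖ := by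
        simp [EuclideanSpace.norm_eq, c, mul_pow]
      rw [this, norm_smul, Real.norm_of_nonneg (by positivity)]
    have hle : ‖c‖ ≤ theta D := by
      refine le_csSup (theta_bddAbove D) ⟨c, fun i => le_rfl, fun i => le_rfl, ?_, ?_, rfl⟩
      · have : ∑ k, c k • blockColumn D k = n⁻¹ • D.transpose.toEuclideanLin v := by
          simp [c, transpose_eq_sum, Finset.smul_sum, mul_smul, blockColumn]
        rw [this, norm_smul, Real.norm_of_nonneg (by positivity), ← hn, inv_mul_cancel₀ hnpos.ne']
      · let e : {k // c k ≠ 0} → {j // v j ≠ 0} := fun k =>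
          match k with
          | ⟨Sum.inl i, h⟩ => absurd rfl h
          | ⟨Sum.inr (Sum.inl i), h⟩ => absurd rfl h
          | ⟨Sum.inr (Sum.inr j), h⟩ => ⟨j, fun h0 => h (by simp [c, h0])⟩
        have he : Function.Injective e := by
          rintro ⟨i | i | j, h⟩ ⟨i' | i' | j', h'⟩ heq
          all_goals first | exact absurd rfl h | exact absurd rfl h' | skip
          simpa [e] using heq
        have hcomp : (fun k : {k // c k ≠ 0} => blockColumn D k.1) =
            (fun j : {j // v j ≠ 0} =>
              (WithLp.toLp 2 (D j) : EuclideanSpace ℝ (Fin d))) ∘ e := by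
          funext ⟨k, h⟩
          rcases k with i | i | j
          · exact absurd rfl h
          · exact absurd rfl h
          · rfl
        rw [hcomp]
        exact hv.comp e he
    rw [hnorm, inv_mul_le_iff₀ hnpos] at hle
    linarith

variable {D}

/-- Test `θ(D)` on a coordinate vector of a nonzero row. It later gives `ℓ ≤ τ σ`. -/
theorem one_le_theta_sq_mul_sigmaMax (hD : D ≠ 0) : 1 ≤ theta D ^ 2 * sigmaMax D := by
  obtain ⟨j, hj⟩ := exists_row_ne_zero hD
  have hsupp : ∀ k : {k // (EuclideanSpace.single j (1 : ℝ)) k ≠ 0}, k.1 = j := by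
    rintro ⟨k, hk⟩
    by_contra hne
    simp [hne] at hk
  have h := norm_le_theta_mul D (EuclideanSpace.single j 1) (by
    have : Subsingleton {k // (EuclideanSpace.single j (1 : ℝ)) k ≠ 0} :=
      ⟨fun a b => Subtype.ext ((hsupp a).trans (hsupp b).symm)⟩
    rw [linearIndependent_subsingleton_index_iff]
    intro k
    rwa [hsupp k])
  have h1 := norm_transpose_sq_le D (EuclideanSpace.single j 1)
  rw [show ‖EuclideanSpace.single j (1 : ℝ)‖ = 1 by simp] at h h1
  have h2 : 1 ≤ (theta D * ‖D.transpose.toEuclideanLin (EuclideanSpace.single j 1)‖) ^ 2 :=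
    one_le_pow₀ h
  nlinarith [sq_nonneg (theta D)]

theorem theta_pos (hD : D ≠ 0) : 0 < theta D := by
  have h1 := one_le_theta_sq_mul_sigmaMax hD
  have h0 : 0 ≤ theta D := by
    apply Real.sSup_nonneg
    rintro r ⟨c, -, -, -, -, rfl⟩
    exact norm_nonneg c
  refine h0.lt_of_ne fun h => ?_
  rw [← h] at h1
  norm_num at h1

/-- Conic Carathéodory theorem: a vector can be replaced by a sign-compatible one with the same
image that is supported on linearly independent rows. -/
theorem exists_conformal_linearIndependent (w : EuclideanSpace ℝ (Fin m)) :
    ∃ v : EuclideanSpace ℝ (Fin m),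
      (∀ i, 0 ≤ v i * w i) ∧ (∀ i, w i = 0 → v i = 0) ∧
      D.transpose.toEuclideanLin v = D.transpose.toEuclideanLin w ∧
      LinearIndependent ℝ (fun j : {j // v j ≠ 0} =>
        (WithLp.toLp 2 (D j) : EuclideanSpace ℝ (Fin d))) := by
  classical
  let Q : ℕ → Prop := fun n => ∃ v : EuclideanSpace ℝ (Fin m),
      (∀ i, 0 ≤ v i * w i) ∧ (∀ i, w i = 0 → v i = 0) ∧
      D.transpose.toEuclideanLin v = D.transpose.toEuclideanLin w ∧
      -- A competitor of minimal support is chosen; a linear dependence among its rows would shrink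
      -- the support.
      (Finset.univ.filter fun i => v i ≠ 0).card = n
  have hQ : ∃ n, Q n := ⟨_, w, fun i => mul_self_nonneg _, fun i h => h, rfl, rfl⟩
  obtain ⟨v, hv1, hv2, hv3, hv4⟩ := Nat.find_spec hQ
  refine ⟨v, hv1, hv2, hv3, ?_⟩
  by_contra hdep
  rw [Fintype.linearIndependent_iff] at hdep
  push Not at hdep
  obtain ⟨g, hg, ⟨j₀, hj₀v⟩, hj₀⟩ := hdep
  obtain ⟨z, hzsupp, hzker, j, hj⟩ : ∃ z : EuclideanSpace ℝ (Fin m), (∀ i, v i = 0 → z i = 0) ∧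
      D.transpose.toEuclideanLin z = 0 ∧ ∃ j, 0 < z j * v j := by
    let z : EuclideanSpace ℝ (Fin m) :=
      WithLp.toLp 2 (fun i => if h : v i ≠ 0 then g ⟨i, h⟩ else 0)
    have hz1 : ∀ i, v i = 0 → z i = 0 := fun i hi => by simp [z, hi]
    have hz2 : D.transpose.toEuclideanLin z = 0 := by
      rw [transpose_eq_sum, ← hg]
      refine (Fintype.sum_of_injective Subtype.val Subtype.val_injective _ _
        (fun k hk => ?_) fun k => ?_).symm
      · have : v k = 0 := by simpa using hk
        simp [z, this]
      · simp [z, k.2]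
    have hz3 : z j₀ * v j₀ ≠ 0 := mul_ne_zero (by simpa [z, hj₀v] using hj₀) hj₀v
    rcases lt_or_gt_of_ne hz3 with hneg | hpos
    · exact ⟨-z, fun i hi => by simp [hz1 i hi], by simp [hz2], j₀, by simpa using hneg⟩
    · exact ⟨z, hz1, hz2, j₀, hpos⟩
  obtain ⟨i₀, hi₀, hmin⟩ := Finset.exists_min_image
    (Finset.univ.filter fun i => 0 < z i * v i) (fun i => v i / z i) ⟨j, by simpa using hj⟩
  simp only [Finset.mem_filter, Finset.mem_univ, true_and] at hi₀ hmin
  have hz0 : z i₀ ≠ 0 := fun h => by simp [h] at hi₀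
  have hv0 : v i₀ ≠ 0 := fun h => by simp [h] at hi₀
  -- Moving from `v` along `-z`, this is the first step length at which an entry vanishes; up to it
  -- no entry changes sign.
  set s := v i₀ / z i₀ with hs
  have hspos : 0 < s := by
    have h1 : s = z i₀ * v i₀ / z i₀ ^ 2 := by
      rw [hs, pow_two, mul_div_mul_left _ _ hz0]
    rw [h1]
    exact div_pos hi₀ (sq_pos_of_ne_zero hz0)
  have hkeep : ∀ i, 0 ≤ (v i - s * z i) * v i := by
    intro i
    rcases le_or_gt (z i * v i) 0 with h | h
    · nlinarith [mul_self_nonneg (v i)]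
    · have h1 := hmin i h
      have hzi : z i ≠ 0 := fun h0 => by simp [h0] at h
      have h2 : s * (z i * v i) ≤ v i / z i * (z i * v i) := mul_le_mul_of_nonneg_right h1 h.le
      have h3 : v i / z i * (z i * v i) = v i * v i := by field_simp
      nlinarith
  have hlt : (Finset.univ.filter fun i => (v - s • z) i ≠ 0).card < Nat.find hQ := by
    rw [← hv4]
    apply Finset.card_lt_card
    rw [Finset.ssubset_iff_of_subset]
    · refine ⟨i₀, by simpa using hv0, ?_⟩
      simp [hs, hz0]
    · intro i hi
      simp only [Finset.mem_filter, Finset.mem_univ, true_and] at hi ⊢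
      intro h
      exact hi (by simp [h, hzsupp i h])
  refine Nat.find_min hQ hlt ⟨v - s • z, ?_, ?_, ?_, rfl⟩
  · intro i
    rcases eq_or_ne (v i) 0 with h | h
    · simp [h, hzsupp i h]
    · have h1 := mul_nonneg (hkeep i) (hv1 i)
      have h2 : 0 < v i ^ 2 := sq_pos_of_ne_zero h
      simp only [PiLp.sub_apply, PiLp.smul_apply, smul_eq_mul]
      refine nonneg_of_mul_nonneg_left (b := v i ^ 2) ?_ h2
      nlinarith
  · intro i hi
    simp [hv2 i hi, hzsupp i (hv2 i hi)]
  · rw [map_sub, map_smul, hzker, smul_zero, sub_zero, hv3]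

end Theta

/-! ### Geometry of the box. -/

section Box

variable {m : ℕ} {lam : ℝ}

theorem isCompact_box : IsCompact (box m lam) := by
  refine Metric.isCompact_of_isClosed_isBounded ?_ ?_
  · have : box m lam = ⋂ i, {α | |α i| ≤ lam} := by
      ext α
      simp [box]
    rw [this]
    exact isClosed_iInter fun i => isClosed_le (by fun_prop) continuous_const
  · refine (Metric.isBounded_iff_subset_closedBall 0).2 ⟨Real.sqrt (∑ _i : Fin m, lam ^ 2), ?_⟩
    intro α hα
    rw [mem_closedBall_zero_iff, EuclideanSpace.norm_eq]
    refine Real.sqrt_le_sqrt (Finset.sum_le_sum fun i _ => ?_)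
    rw [Real.norm_eq_abs]
    exact pow_le_pow_left₀ (abs_nonneg _) (hα i) 2

theorem norm_sub_sq_le_of_mem_box {α α' : EuclideanSpace ℝ (Fin m)} (h : α ∈ box m lam)
    (h' : α' ∈ box m lam) : ‖α - α'‖ ^ 2 ≤ 4 * lam ^ 2 * m := by
  rw [EuclideanSpace.norm_sq_eq]
  refine (Finset.sum_le_card_nsmul _ _ (4 * lam ^ 2) fun i _ => ?_).trans (le_of_eq ?_)
  · have h1 := abs_le.1 (h i)
    have h2 := abs_le.1 (h' i)
    rw [Real.norm_eq_abs, sq_abs, PiLp.sub_apply]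
    nlinarith
  · simp [mul_comm]

theorem inner_sub_boxProj_nonpos (hl : 0 ≤ lam) (x : EuclideanSpace ℝ (Fin m))
    {p : EuclideanSpace ℝ (Fin m)} (hp : p ∈ box m lam) :
    inner ℝ (x - boxProj lam x) (p - boxProj lam x) ≤ 0 := by
  rw [PiLp.inner_apply]
  refine Finset.sum_nonpos fun i _ => ?_
  have h := abs_le.1 (hp i)
  simp only [boxProj, PiLp.sub_apply, RCLike.inner_apply, conj_trivial]
  rcases le_total lam (x i) with h1 | h1
  · rw [min_eq_left h1, max_eq_right (by linarith)]
    exact mul_nonpos_of_nonpos_of_nonneg (by linarith) (by linarith)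
  · rw [min_eq_right h1]
    rcases le_total (-lam) (x i) with h2 | h2
    · rw [max_eq_right h2]
      simp
    · rw [max_eq_left h2]
      exact mul_nonpos_of_nonneg_of_nonpos (by linarith) (by linarith)

end Box

variable {m d : ℕ} {f : EuclideanSpace ℝ (Fin d) → ℝ} {μ ℓ lam : ℝ}
  {D : Matrix (Fin m) (Fin d) ℝ}

/-! ### The Hoffman bound over the box. -/

section Hoffman

/-- For small `s` each entry of `s • v` has the sign of that of `w` and is no larger, so `q + s • v`
lies coordinatewise between `q` and `q + w`. -/
theorem exists_conformal_step {q v w : EuclideanSpace ℝ (Fin m)} (hq : q ∈ box m lam)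
    (hqw : q + w ∈ box m lam) (hv : ∀ i, 0 ≤ v i * w i) (hv0 : ∀ i, w i = 0 → v i = 0) :
    ∃ s : ℝ, 0 < s ∧ s ≤ 1 ∧ q + s • v ∈ box m lam := by
  have hev : ∀ᶠ s in nhdsWithin (0 : ℝ) (Set.Ioi 0), ∀ i, |s * v i| ≤ |w i| := by
    rw [Filter.eventually_all]
    intro i
    rcases eq_or_ne (w i) 0 with h | h
    · simp [hv0 i h]
    · have hc : Filter.Tendsto (fun s : ℝ => |s * v i|) (nhds 0) (nhds 0) := by
        have : Continuous fun s : ℝ => |s * v i| := by fun_prop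
        simpa using this.tendsto 0
      exact ((hc.eventually_lt_const (abs_pos.2 h)).mono fun s hs => hs.le).filter_mono
        nhdsWithin_le_nhds
  obtain ⟨s, hs, hs0, hs1⟩ := (hev.and (Ioc_mem_nhdsGT one_pos)).exists
  refine ⟨s, hs0, hs1, fun i => ?_⟩
  have h1 := abs_le.1 (hq i)
  have h2 := abs_le.1 (hqw i)
  have h3 := hs i
  have h4 : 0 ≤ s * v i * w i := by
    rw [mul_assoc]
    exact mul_nonneg hs0.le (hv i)
  rw [abs_le]
  simp only [PiLp.add_apply, PiLp.smul_apply, smul_eq_mul] at *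
  generalize s * v i = u at *
  rcases lt_trichotomy (w i) 0 with h | h | h
  · have h5 : u ≤ 0 := by nlinarith
    rw [abs_of_nonpos h5, abs_of_neg h] at h3
    constructor <;> linarith
  · rw [h, abs_zero, abs_nonpos_iff] at h3
    constructor <;> linarith
  · have h5 : 0 ≤ u := by nlinarith
    rw [abs_of_nonneg h5, abs_of_pos h] at h3
    constructor <;> linarith

/-- Hoffman-type bound: the distance of a point of the box to the points of the box with a
prescribed image under `Dᵀ` is controlled by the distance of the images. -/
theorem exists_mem_box_near (hD : D ≠ 0) {α αs : EuclideanSpace ℝ (Fin m)}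
    (hα : α ∈ box m lam) (hαs : αs ∈ box m lam) :
    ∃ p ∈ box m lam, D.transpose.toEuclideanLin p = D.transpose.toEuclideanLin αs ∧
      ‖α - p‖ ≤ 2 * theta D * ‖D.transpose.toEuclideanLin (α - αs)‖ := by
  have hθ := theta_pos hD
  have hcont : Continuous fun q : EuclideanSpace ℝ (Fin m) =>
      ‖q - α‖ + 2 * theta D * ‖D.transpose.toEuclideanLin (q - αs)‖ := by
    have : Continuous (D.transpose.toEuclideanLin) := LinearMap.continuous_of_finiteDimensional _
    fun_prop
  -- Exact penalty: at a minimizer the constraint holds, since a conformal step of length `s` would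
  -- cost at most `s θ ‖Dᵀ(q - αs)‖` and gain twice that. Comparison with `α` then gives the
  -- distance bound.
  obtain ⟨q, hq, hmin⟩ := isCompact_box.exists_isMinOn ⟨α, hα⟩ hcont.continuousOn
  rw [isMinOn_iff] at hmin
  have hqr : D.transpose.toEuclideanLin (q - αs) = 0 := by
    by_contra hne
    have hr := norm_pos_iff.2 hne
    obtain ⟨v, hv1, hv2, hv3, hv4⟩ := exists_conformal_linearIndependent (D := D) (αs - q)
    obtain ⟨s, hs0, hs1, hsbox⟩ :=
      exists_conformal_step hq (by rwa [add_sub_cancel]) hv1 hv2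
    have h1 := hmin _ hsbox
    have h2 := norm_le_theta_mul D v hv4
    have h3 : D.transpose.toEuclideanLin (q + s • v - αs) =
        (1 - s) • D.transpose.toEuclideanLin (q - αs) := by
      rw [add_sub_right_comm, map_add, map_smul, hv3, ← neg_sub q αs, map_neg, sub_smul, one_smul,
        smul_neg]
      abel
    have h4 : ‖q + s • v - α‖ ≤ ‖q - α‖ + s * ‖v‖ := by
      rw [add_sub_right_comm]
      refine (norm_add_le _ _).trans (le_of_eq ?_)
      rw [norm_smul, Real.norm_of_nonneg hs0.le]
    rw [hv3, ← neg_sub q αs, map_neg, norm_neg] at h2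
    rw [h3, norm_smul, Real.norm_of_nonneg (by linarith)] at h1
    have h5 := mul_le_mul_of_nonneg_left h2 hs0.le
    have h6 : 0 < s * (theta D * ‖D.transpose.toEuclideanLin (q - αs)‖) := by positivity
    nlinarith
  refine ⟨q, hq, ?_, ?_⟩
  · rw [map_sub] at hqr
    exact sub_eq_zero.1 hqr
  · have h1 := hmin α hα
    rw [hqr, sub_self, norm_zero, norm_zero, mul_zero, add_zero, zero_add, norm_sub_rev] at h1
    exact h1

end Hoffman

/-! ### Dual function, dual gap and the inexact dual step. -/

section Duality

theorem lagrangian_eq_sub (α α' : EuclideanSpace ℝ (Fin m)) (β : EuclideanSpace ℝ (Fin d)) :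
    lagrangian f D α' β = lagrangian f D α β - inner ℝ (α' - α) (D.toEuclideanLin β) := by
  simp only [lagrangian, inner_sub_left]
  ring

theorem lagrangian_congr {α α' : EuclideanSpace ℝ (Fin m)}
    (h : D.transpose.toEuclideanLin α = D.transpose.toEuclideanLin α') :
    lagrangian f D α = lagrangian f D α' := by
  funext β
  simp only [lagrangian, inner_toEuclideanLin, h]

theorem norm_gradient_lagrangian (h : IsRegularLoss f μ ℓ) {α : EuclideanSpace ℝ (Fin m)}
    {b : EuclideanSpace ℝ (Fin d)} (hb : IsMinOn (lagrangian f D α) Set.univ b)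
    (α' : EuclideanSpace ℝ (Fin m)) :
    ‖∇ (lagrangian f D α') b‖ = ‖D.transpose.toEuclideanLin (α' - α)‖ := by
  have h1 := (h.lagrangian (D := D) α).gradient_eq_zero hb
  rw [gradient_lagrangian h] at h1 ⊢
  rw [lagrangianGrad, sub_eq_zero] at h1
  rw [lagrangianGrad, h1, norm_sub_rev, map_sub]

/-- Smoothness of the dual function: by `lagrangian_eq_sub`, the first term is its linearization at
`α`, evaluated at `α'`. -/
theorem lagrangian_sub_le (h : IsRegularLoss f μ ℓ) (hμ : 0 < μ) {α : EuclideanSpace ℝ (Fin m)}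
    {b : EuclideanSpace ℝ (Fin d)} (hb : IsMinOn (lagrangian f D α) Set.univ b)
    (α' : EuclideanSpace ℝ (Fin m)) (b' : EuclideanSpace ℝ (Fin d)) :
    lagrangian f D α' b - lagrangian f D α' b' ≤
      ‖D.transpose.toEuclideanLin (α' - α)‖ ^ 2 / (2 * μ) := by
  rw [← norm_gradient_lagrangian h hb]
  exact (h.lagrangian α').gap_le hμ b' b

theorem le_lagrangian_sub (h : IsRegularLoss f μ ℓ) (hℓ : 0 < ℓ)
    {α α' : EuclideanSpace ℝ (Fin m)} {b b' : EuclideanSpace ℝ (Fin d)}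
    (hb : IsMinOn (lagrangian f D α) Set.univ b) (hb' : IsMinOn (lagrangian f D α') Set.univ b') :
    ‖D.transpose.toEuclideanLin (α' - α)‖ ^ 2 / (2 * ℓ) ≤
      lagrangian f D α' b - lagrangian f D α' b' := by
  rw [← norm_gradient_lagrangian h hb]
  exact (h.lagrangian α').gap_ge hℓ hb' b

theorem norm_minimizer_sub_le (h : IsRegularLoss f μ ℓ) (hμ : 0 < μ)
    {α α' : EuclideanSpace ℝ (Fin m)} {b b' : EuclideanSpace ℝ (Fin d)}
    (hb : IsMinOn (lagrangian f D α) Set.univ b) (hb' : IsMinOn (lagrangian f D α') Set.univ b') :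
    ‖b - b'‖ ≤ ‖D.transpose.toEuclideanLin (α' - α)‖ / μ := by
  have h1 := (h.lagrangian (D := D) α').strongly_convex b b'
  rw [(h.lagrangian (D := D) α').gradient_eq_zero hb', sub_zero] at h1
  have h2 := real_inner_le_norm (b - b') (∇ (lagrangian f D α') b)
  rw [norm_gradient_lagrangian h hb] at h2
  rw [le_div_iff₀ hμ]
  rcases (norm_nonneg (b - b')).eq_or_lt with h0 | h0
  · rw [← h0, zero_mul]
    positivity
  · refine le_of_mul_le_mul_left ?_ h0
    nlinarith

theorem norm_minimizer_sub_le_sqrt (h : IsRegularLoss f μ ℓ) (hμ : 0 < μ)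
    {α α' : EuclideanSpace ℝ (Fin m)} {b b' : EuclideanSpace ℝ (Fin d)}
    (hb : IsMinOn (lagrangian f D α) Set.univ b) (hb' : IsMinOn (lagrangian f D α') Set.univ b') :
    ‖b - b'‖ ≤ Real.sqrt (sigmaMax D * ‖α' - α‖ ^ 2) / μ :=
  (norm_minimizer_sub_le h hμ hb hb').trans
    (div_le_div_of_nonneg_right (Real.le_sqrt_of_sq_le (norm_transpose_sq_le D _)) hμ.le)

/-- Existence of a dual optimal point, with the primal optimum as its Lagrangian minimizer. -/
theorem exists_dual_optimal (h : IsRegularLoss f μ ℓ) (hμ : 0 < μ) (hlam : 0 < lam)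
    {βstar : EuclideanSpace ℝ (Fin d)} (hβ : IsMinOn (objective f D lam) Set.univ βstar) :
    ∃ αs ∈ box m lam, IsMinOn (lagrangian f D αs) Set.univ βstar ∧
      ∀ α ∈ box m lam, 0 ≤ inner ℝ (α - αs) (D.toEuclideanLin βstar) := by
  choose b hb using fun α => (h.lagrangian (D := D) α).exists_isMinOn hμ
  have hcont : Continuous fun α => lagrangian f D α (b α) := by
    rw [continuous_iff_continuousAt]
    intro α
    have hlin : Continuous (D.transpose.toEuclideanLin) := LinearMap.continuous_of_finiteDimensional _
    have c1 : Continuous fun α' => lagrangian f D α (b α) -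
        inner ℝ (α' - α) (D.toEuclideanLin (b α)) -
        ‖D.transpose.toEuclideanLin (α' - α)‖ ^ 2 / (2 * μ) := by fun_prop
    have c2 : Continuous fun α' => lagrangian f D α (b α) -
        inner ℝ (α' - α) (D.toEuclideanLin (b α)) := by fun_prop
    have t1 := c1.tendsto α
    have t2 := c2.tendsto α
    simp only [sub_self, map_zero, inner_zero_left, norm_zero, ne_eq, OfNat.ofNat_ne_zero,
      not_false_eq_true, zero_pow, zero_div, sub_zero] at t1 t2
    refine tendsto_of_tendsto_of_tendsto_of_le_of_le t1 t2 (fun α' => ?_) (fun α' => ?_)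
    · have := lagrangian_sub_le h hμ (hb α) α' (b α')
      rw [lagrangian_eq_sub α α' (b α)] at this
      simp only
      linarith
    · have : lagrangian f D α' (b α') ≤ lagrangian f D α' (b α) := hb α' (Set.mem_univ _)
      rwa [lagrangian_eq_sub α α' (b α)] at this
  obtain ⟨αs, hαs, hmax⟩ := isCompact_box.exists_isMaxOn
    ⟨(0 : EuclideanSpace ℝ (Fin m)), fun i => by simpa using hlam.le⟩ hcont.continuousOn
  rw [isMaxOn_iff] at hmax
  have hVI : ∀ α ∈ box m lam, 0 ≤ inner ℝ (α - αs) (D.toEuclideanLin (b αs)) := by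
    intro α hα
    by_contra hneg
    push Not at hneg
    set e := -inner ℝ (α - αs) (D.toEuclideanLin (b αs)) with he
    have hepos : 0 < e := by linarith
    set c := ‖D.transpose.toEuclideanLin (α - αs)‖ ^ 2 / (2 * μ) with hc
    have hc0 : 0 ≤ c := by positivity
    -- Moving by `s` towards `α` raises the dual value by at least `s e - s² c`, which is positive
    -- for this `s`.
    set s := e / (c + e) with hs
    have hs0 : 0 < s := by positivity
    have hs1 : s ≤ 1 := (div_le_one (by positivity)).2 (by linarith)
    have hbox : αs + s • (α - αs) ∈ box m lam := by
      intro i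
      have h1 := abs_le.1 (hα i)
      have h2 := abs_le.1 (hαs i)
      rw [abs_le]
      simp only [PiLp.add_apply, PiLp.smul_apply, PiLp.sub_apply, smul_eq_mul]
      constructor <;> nlinarith
    have h1 := hmax _ hbox
    have h2 := lagrangian_sub_le h hμ (hb αs) (αs + s • (α - αs)) (b (αs + s • (α - αs)))
    rw [lagrangian_eq_sub αs (αs + s • (α - αs)) (b αs), add_sub_cancel_left, map_smul, norm_smul,
      Real.norm_of_nonneg hs0.le, real_inner_smul_left, mul_pow, mul_div_assoc, ← hc] at h2
    have h3 : s * e ≤ s * (s * c) := by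
      rw [he]
      nlinarith
    have h4 : e ≤ s * c := le_of_mul_le_mul_left h3 hs0
    have h5 : s * (c + e) = e := by
      rw [hs]
      field_simp
    nlinarith [mul_pos hs0 hepos]
  -- Complementary slackness, by testing the variational inequality at `-lam * sign (D b)`. With
  -- weak duality it closes the chain `L(αs, β*) ≤ Φ(β*) ≤ Φ(b) ≤ L(αs, b)`.
  have hle : lam * ∑ i, |D.toEuclideanLin (b αs) i| ≤ -inner ℝ αs (D.toEuclideanLin (b αs)) := by
    set y := D.toEuclideanLin (b αs) with hy
    let α : EuclideanSpace ℝ (Fin m) := WithLp.toLp 2 fun i => -(lam * SignType.sign (y i))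
    have hα : α ∈ box m lam := by
      intro i
      simp only [α]
      rcases lt_trichotomy (y i) 0 with h | h | h <;> simp [h, abs_of_pos hlam, hlam.le]
    have h1 := hVI α hα
    have h2 : inner ℝ α y = -(lam * ∑ i, |y i|) := by
      rw [PiLp.inner_apply, Finset.mul_sum, ← Finset.sum_neg_distrib]
      refine Finset.sum_congr rfl fun i _ => ?_
      simp only [α, RCLike.inner_apply, conj_trivial]
      rw [← self_mul_sign (y i)]
      ring
    rw [inner_sub_left, h2] at h1
    linarith
  have hdual : ∀ β, lagrangian f D αs β ≤ objective f D lam β := by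
    intro β
    have : -inner ℝ αs (D.toEuclideanLin β) ≤ lam * ∑ i, |D.toEuclideanLin β i| := by
      rw [PiLp.inner_apply, Finset.mul_sum, ← Finset.sum_neg_distrib]
      refine Finset.sum_le_sum fun i _ => ?_
      simp only [RCLike.inner_apply, conj_trivial]
      refine (neg_le_abs _).trans ?_
      rw [abs_mul, mul_comm]
      exact mul_le_mul_of_nonneg_right (hαs i) (abs_nonneg _)
    simp only [lagrangian, objective]
    linarith
  have hbs : IsMinOn (lagrangian f D αs) Set.univ βstar := by
    intro β _
    have h1 : objective f D lam βstar ≤ objective f D lam (b αs) := hβ (Set.mem_univ _)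
    have h2 : lagrangian f D αs (b αs) ≤ lagrangian f D αs β := hb αs (Set.mem_univ _)
    have h3 := hdual βstar
    simp only [Set.mem_ofPred_eq]
    refine h3.trans (h1.trans (le_trans ?_ h2))
    simp only [lagrangian, objective]
    linarith
  have heq : b αs = βstar := (h.lagrangian αs).isMinOn_unique hμ (hb αs) hbs
  exact ⟨αs, hαs, hbs, by rwa [heq] at hVI⟩

/-- By `hVI` the gap is at least `L(α, β*) - L(α, b)`, which growth in the gradient and in the
distance bound from below. -/
theorem dual_gap_bounds (h : IsRegularLoss f μ ℓ) (hℓ : 0 < ℓ)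
    {αs α : EuclideanSpace ℝ (Fin m)} {βstar b : EuclideanSpace ℝ (Fin d)}
    (hβ : IsMinOn (lagrangian f D αs) Set.univ βstar)
    (hVI : 0 ≤ inner ℝ (α - αs) (D.toEuclideanLin βstar))
    (hb : IsMinOn (lagrangian f D α) Set.univ b) :
    ‖D.transpose.toEuclideanLin (α - αs)‖ ^ 2 / (2 * ℓ) ≤
        lagrangian f D αs βstar - lagrangian f D α b ∧
      μ / 2 * ‖b - βstar‖ ^ 2 ≤ lagrangian f D αs βstar - lagrangian f D α b := by
  have h1 := le_lagrangian_sub h hℓ hβ hb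
  have h2 := (h.lagrangian α).quadratic_growth hb βstar
  rw [norm_sub_rev] at h2
  have h3 := lagrangian_eq_sub (f := f) (D := D) αs α βstar
  constructor <;> linarith

/-- One inexact projected dual gradient step. -/
theorem dual_step (h : IsRegularLoss f μ ℓ) (hμ : 0 < μ) (hℓ : 0 < ℓ) (hlam : 0 < lam)
    {η r : ℝ} (hη : 0 < η) (hησ : η * sigmaMax D ≤ μ)
    {αs α p : EuclideanSpace ℝ (Fin m)} {βstar b b' β : EuclideanSpace ℝ (Fin d)}
    (hβs : IsMinOn (lagrangian f D αs) Set.univ βstar)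
    (hVI : ∀ α ∈ box m lam, 0 ≤ inner ℝ (α - αs) (D.toEuclideanLin βstar))
    (hb : IsMinOn (lagrangian f D α) Set.univ b) (hβ : ‖β - b‖ ≤ r)
    (hb' : IsMinOn (lagrangian f D (boxProj lam (α - η • D.toEuclideanLin β))) Set.univ b')
    (hp : p ∈ box m lam)
    (hpeq : D.transpose.toEuclideanLin p = D.transpose.toEuclideanLin αs) :
    ‖boxProj lam (α - η • D.toEuclideanLin β) - p‖ ^ 2 ≤ ‖α - p‖ ^ 2 -
      η * (lagrangian f D αs βstar -
        lagrangian f D (boxProj lam (α - η • D.toEuclideanLin β)) b') + 2 * η * ℓ * r ^ 2 := by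
  have hproj := inner_sub_boxProj_nonpos hlam.le (α - η • D.toEuclideanLin β) hp
  have hmem := boxProj_mem hlam.le (α - η • D.toEuclideanLin β)
  set a := boxProj lam (α - η • D.toEuclideanLin β) with ha
  obtain ⟨hgap, -⟩ := dual_gap_bounds h hℓ hβs (hVI a hmem) hb'
  rw [sub_right_comm, inner_sub_left, real_inner_smul_left] at hproj
  have hid : ‖α - p‖ ^ 2 = ‖a - α‖ ^ 2 + ‖a - p‖ ^ 2 - 2 * inner ℝ (α - a) (p - a) := by
    have h1 := norm_sub_sq_real (α - a) (p - a)
    rw [sub_sub_sub_cancel_right, norm_sub_rev α a, norm_sub_rev p a] at h1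
    linarith
  -- Concavity of the dual function; `p` and `αs` have the same Lagrangian.
  have hI1 : inner ℝ (p - α) (D.toEuclideanLin b) ≤
      lagrangian f D α b - lagrangian f D αs βstar := by
    have h1 : lagrangian f D αs βstar ≤ lagrangian f D αs b := hβs (Set.mem_univ _)
    have h2 := lagrangian_eq_sub (f := f) (D := D) α p b
    rw [lagrangian_congr hpeq] at h2
    linarith
  have hI2 : -inner ℝ (a - α) (D.toEuclideanLin b) ≤ lagrangian f D a b' - lagrangian f D α b +
      ‖D.transpose.toEuclideanLin (a - α)‖ ^ 2 / (2 * μ) := by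
    have h1 := lagrangian_sub_le h hμ hb a b'
    rw [lagrangian_eq_sub α a b] at h1
    linarith
  have hσ : 2 * η * (‖D.transpose.toEuclideanLin (a - α)‖ ^ 2 / (2 * μ)) ≤ ‖a - α‖ ^ 2 := by
    have h1 := norm_transpose_sq_le D (a - α)
    have h2 : 2 * η * (‖D.transpose.toEuclideanLin (a - α)‖ ^ 2 / (2 * μ)) =
        η * ‖D.transpose.toEuclideanLin (a - α)‖ ^ 2 / μ := by
      field_simp
    rw [h2, div_le_iff₀ hμ]
    nlinarith [mul_le_mul_of_nonneg_left h1 hη.le,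
      mul_le_mul_of_nonneg_right hησ (sq_nonneg ‖a - α‖)]
  -- `Dᵀ(p - a)` equals `Dᵀ(αs - a)`, whose square is at most `2ℓ` times the gap; Young's inequality
  -- then charges half the gap to the error.
  have herr : inner ℝ (D.toEuclideanLin (β - b)) (p - a) ≤
      ℓ * r ^ 2 + (lagrangian f D αs βstar - lagrangian f D a b') / 2 := by
    rw [real_inner_comm, inner_toEuclideanLin]
    have h1 : ‖D.transpose.toEuclideanLin (p - a)‖ = ‖D.transpose.toEuclideanLin (a - αs)‖ := by
      rw [map_sub, map_sub, hpeq, norm_sub_rev]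
    have h2 := real_inner_le_norm (D.transpose.toEuclideanLin (p - a)) (β - b)
    rw [h1] at h2
    set z := ‖D.transpose.toEuclideanLin (a - αs)‖ with hz
    have hz0 : 0 ≤ z := norm_nonneg _
    have h3 : z * ‖β - b‖ ≤ z * r := mul_le_mul_of_nonneg_left hβ hz0
    have h4 : ℓ * r ^ 2 + z ^ 2 / (2 * ℓ) / 2 - z * r = (2 * ℓ * r - z) ^ 2 / (4 * ℓ) := by
      field_simp
      ring
    have h5 : 0 ≤ (2 * ℓ * r - z) ^ 2 / (4 * ℓ) := by positivity
    linarith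
  have hsplit : inner ℝ (D.toEuclideanLin β) (p - a) =
      inner ℝ (p - α) (D.toEuclideanLin b) - inner ℝ (a - α) (D.toEuclideanLin b) +
        inner ℝ (D.toEuclideanLin (β - b)) (p - a) := by
    have h1 : inner ℝ (D.toEuclideanLin b) (p - a) =
        inner ℝ p (D.toEuclideanLin b) - inner ℝ a (D.toEuclideanLin b) := by
      rw [real_inner_comm, inner_sub_left]
    simp only [map_sub, inner_sub_left, h1]
    ring
  have hfin : η * inner ℝ (D.toEuclideanLin β) (p - a) ≤
      η * (-(lagrangian f D αs βstar - lagrangian f D a b') / 2 +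
        ‖D.transpose.toEuclideanLin (a - α)‖ ^ 2 / (2 * μ) + ℓ * r ^ 2) := by
    refine mul_le_mul_of_nonneg_left ?_ hη.le
    linarith
  linarith

end Duality

/-! ### Numerical estimates for the tolerance and the logarithms. -/

section Tolerance

variable {μ ℓ τ σ η ε r : ℝ}

/-- The tolerance condition bounds the inexactness relative to the target accuracy. -/
theorem sq_tolerance_le (hμ : 0 < μ) (hℓ : 0 < ℓ) (hτ : 0 < τ) (hσ : 0 < σ) (hη : 0 < η)
    (hε : 0 < ε) (hr : 0 < r) (hτσ : ℓ ≤ τ * σ)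
    (h : r ≤ μ * Real.sqrt ε / (4 * Real.sqrt ℓ) *
      Real.sqrt (τ / (tolConst τ σ (ℓ / μ) * (17 * τ ^ 2 + (14 + η) * τ + 1)))) :
    136 * (ℓ * r ^ 2) ≤ μ * ε := by
  set A := tolConst τ σ (ℓ / μ) with hA
  have hA1 : σ * μ / (2 * ℓ) ≤ A := by
    have h1 : σ / (2 * (ℓ / μ)) = σ * μ / (2 * ℓ) := by field_simp
    have h2 : 0 ≤ 2 * τ ^ 2 * σ / (17 * τ ^ 2 + 6 * τ + 9) := by positivity
    rw [hA, tolConst, h1]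
    linarith
  set B := 17 * τ ^ 2 + (14 + η) * τ + 1 with hB
  have hB1 : 17 * τ ^ 2 ≤ B := by
    have : 0 ≤ (14 + η) * τ := by positivity
    linarith
  have hA0 : 0 < A := lt_of_lt_of_le (by positivity) hA1
  have hB0 : 0 < B := lt_of_lt_of_le (by positivity) hB1
  -- Only `σ/(2κ)` of the constant and `17τ²` of the polynomial are kept; then `136 = 16 · 17 / 2`.
  have hY : τ / (A * B) ≤ 2 / (17 * μ) := by
    rw [div_le_div_iff₀ (by positivity) (by positivity)]
    have h1 : σ * μ / (2 * ℓ) * (17 * τ ^ 2) ≤ A * B :=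
      mul_le_mul hA1 hB1 (by positivity) hA0.le
    have h2 : σ * μ / (2 * ℓ) * (17 * τ ^ 2) = 17 * μ * τ / 2 * (τ * σ / ℓ) := by field_simp
    have h3 : 1 ≤ τ * σ / ℓ := (one_le_div hℓ).2 hτσ
    have h4 : 17 * μ * τ / 2 * 1 ≤ 17 * μ * τ / 2 * (τ * σ / ℓ) :=
      mul_le_mul_of_nonneg_left h3 (by positivity)
    linarith
  have h1 := pow_le_pow_left₀ hr.le h 2
  rw [mul_pow, div_pow, mul_pow, mul_pow, Real.sq_sqrt hε.le, Real.sq_sqrt hℓ.le,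
    Real.sq_sqrt (by positivity)] at h1
  have h2 : r ^ 2 ≤ μ ^ 2 * ε / (4 ^ 2 * ℓ) * (2 / (17 * μ)) :=
    h1.trans (mul_le_mul_of_nonneg_left hY (by positivity))
  have h3 : 136 * (ℓ * (μ ^ 2 * ε / (4 ^ 2 * ℓ) * (2 / (17 * μ)))) = μ * ε := by
    field_simp
    norm_num
  rw [← h3]
  gcongr

/-- Uses `log(1 + x) ≥ x/(1 + x)`. The factor `4κ` makes the logarithm at least `log 4 > 1`, which
absorbs the additive `1`. -/
theorem pow_lt_imp_le_mul_log {x K W κ : ℝ} {n : ℕ} (hx : 0 < x) (hxK : 1 / x ≤ K) (hK : 1 ≤ K)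
    (hκ : 1 ≤ κ) (hn : (1 + x) ^ n < W) :
    1 < W ∧ (n : ℝ) + 1 ≤ 3 * (K * Real.log (4 * κ * W)) := by
  have hW : 1 < W := (one_le_pow₀ (by linarith)).trans_lt hn
  refine ⟨hW, ?_⟩
  have h1 : (n : ℝ) * Real.log (1 + x) ≤ Real.log W := by
    rw [← Real.log_pow]
    exact Real.log_le_log (by positivity) hn.le
  have h2 : Real.log W ≤ Real.log (4 * κ * W) := Real.log_le_log (by linarith) (by nlinarith)
  have h3 : 1 ≤ Real.log (4 * κ * W) := by
    have h4 : Real.log 4 ≤ Real.log (4 * κ * W) := Real.log_le_log (by norm_num) (by nlinarith)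
    have h5 : Real.log 4 = 2 * Real.log 2 := by
      rw [show (4 : ℝ) = 2 ^ 2 by norm_num, Real.log_pow]
      norm_num
    have := Real.log_two_gt_d9
    linarith
  have h6 : x / (1 + x) ≤ Real.log (1 + x) := by
    have := Real.one_sub_inv_le_log_of_pos (show 0 < 1 + x by linarith)
    have h7 : x / (1 + x) = 1 - (1 + x)⁻¹ := by
      field_simp
      ring
    linarith
  set L := Real.log (4 * κ * W)
  have h8 : (n : ℝ) * (x / (1 + x)) ≤ L :=
    (mul_le_mul_of_nonneg_left h6 n.cast_nonneg).trans (h1.trans h2)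
  have h9 : (n : ℝ) ≤ L * (1 + 1 / x) := by
    have h10 : (n : ℝ) * (x / (1 + x)) * (1 + 1 / x) = n := by
      field_simp
      ring
    rw [← h10]
    exact mul_le_mul_of_nonneg_right h8 (by positivity)
  have h11 : L * (1 + 1 / x) ≤ L * (K + K) :=
    mul_le_mul_of_nonneg_left (by linarith) (by linarith)
  have h12 : 1 ≤ K * L := one_le_mul_of_one_le_of_one_le hK h3
  linarith

theorem log_restart_le {X : ℝ} (hr : 0 < r) (hr1 : r < 1) (hrX : r ≤ X) :
    Real.log (1 + (r + X) / r) ≤ 2 * Real.log ((1 + X) / r) := by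
  have hq : 2 ≤ (1 + X) / r := by
    rw [le_div_iff₀ hr]
    linarith
  have h1 : 1 + (r + X) / r ≤ ((1 + X) / r) ^ 2 := by
    have h2 : 1 + (r + X) / r = 2 + X / r := by field_simp; ring
    have h3 : (1 + X) / r = 1 / r + X / r := add_div _ _ _
    have h4 : 1 ≤ 1 / r := (one_le_div hr).2 hr1.le
    have h5 : 0 ≤ X / r := div_nonneg (hr.le.trans hrX) hr.le
    nlinarith
  have h6 : 0 < 1 + (r + X) / r := by
    have : 0 ≤ (r + X) / r := div_nonneg (by linarith) hr.le
    linarith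
  refine (Real.log_le_log h6 h1).trans (le_of_eq ?_)
  rw [Real.log_pow]
  norm_num

end Tolerance

/-! ### The outer iteration. -/

namespace Run

variable {m d : ℕ} {R : Run m d}

theorem dual_mem_box (hlam : 0 < R.lam) (h0 : R.α₀ ∈ box m R.lam) (t : ℕ) :
    R.dual t ∈ box m R.lam := by
  cases t with
  | zero => exact h0
  | succ t => exact boxProj_mem hlam.le _

theorem primal_isApproxMinimizer (hf : IsRegularLoss R.f R.μ R.ℓ) (hμ : 0 < R.μ)
    (hμℓ : R.μ ≤ R.ℓ) (hr : 0 < R.epsHat) (t : ℕ) :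
    IsApproxMinimizer (lagrangian R.f R.D (R.dual t)) R.epsHat (R.primal t) :=
  innerSolve_isApproxMinimizer hf hμ hμℓ _ _ hr

/-- Warm start: the previous output is within `epsHat` of its own minimizer, and the two minimizers
differ by at most `√σ/μ` times the diameter `2λ√m` of the box. -/
theorem calls_succ_le (hf : IsRegularLoss R.f R.μ R.ℓ) (hμ : 0 < R.μ) (hμℓ : R.μ ≤ R.ℓ)
    (hlam : 0 < R.lam) (h0 : R.α₀ ∈ box m R.lam) (hσ : 0 < sigmaMax R.D) (hr : 0 < R.epsHat)
    (t : ℕ) :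
    (R.calls (t + 1) : ℝ) ≤ 10 * (Real.sqrt (R.ℓ / R.μ) * Real.log (1 +
      (R.epsHat + 2 * R.lam * Real.sqrt (sigmaMax R.D * m) / R.μ) / R.epsHat)) := by
  obtain ⟨b, hb, hβ⟩ := primal_isApproxMinimizer hf hμ hμℓ hr t
  obtain ⟨b', hb'⟩ := (hf.lagrangian (D := R.D) (R.dual (t + 1))).exists_isMinOn hμ
  refine (innerCalls_le hf hμ hμℓ (R.primal t) hr hb').trans ?_
  have h1 := norm_minimizer_sub_le_sqrt hf hμ hb hb'
  have h2 := norm_sub_sq_le_of_mem_box (dual_mem_box hlam h0 (t + 1)) (dual_mem_box hlam h0 t)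
  have h3 : Real.sqrt (sigmaMax R.D * ‖R.dual (t + 1) - R.dual t‖ ^ 2) ≤
      2 * R.lam * Real.sqrt (sigmaMax R.D * m) := by
    refine Real.sqrt_le_iff.2 ⟨by positivity, ?_⟩
    rw [mul_pow, mul_pow, Real.sq_sqrt (by positivity)]
    nlinarith
  have h4 : ‖R.primal t - b'‖ ≤ R.epsHat + 2 * R.lam * Real.sqrt (sigmaMax R.D * m) / R.μ := by
    refine (norm_sub_le_norm_sub_add_norm_sub (R.primal t) b b').trans ?_
    exact add_le_add hβ (h1.trans (div_le_div_of_nonneg_right h3 hμ.le))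
  have h5 : 0 ≤ ‖R.primal t - b'‖ / R.epsHat := by positivity
  gcongr

/-- As long as no primal iterate is accurate, the distance to the dual optimal set contracts
geometrically. -/
theorem exists_dual_near (hf : IsRegularLoss R.f R.μ R.ℓ) (hμ : 0 < R.μ) (hμℓ : R.μ ≤ R.ℓ)
    (hD : R.D ≠ 0) (hlam : 0 < R.lam) (h0 : R.α₀ ∈ box m R.lam) (hη : 0 < R.η)
    (hησ : R.η * sigmaMax R.D ≤ R.μ) (hr : 0 < R.epsHat) {ε : ℝ} (hε : 0 < ε)
    (hrε : R.epsHat ≤ Real.sqrt ε / 2) (htol : 136 * (R.ℓ * R.epsHat ^ 2) ≤ R.μ * ε)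
    {αs : EuclideanSpace ℝ (Fin m)} {βstar : EuclideanSpace ℝ (Fin d)}
    (hαs : αs ∈ box m R.lam) (hβs : IsMinOn (lagrangian R.f R.D αs) Set.univ βstar)
    (hVI : ∀ α ∈ box m R.lam, 0 ≤ inner ℝ (α - αs) (R.D.toEuclideanLin βstar)) (n : ℕ)
    (hn : ∀ t ≤ n, ε < ‖R.primal t - βstar‖ ^ 2) :
    ∃ p ∈ box m R.lam, R.D.transpose.toEuclideanLin p = R.D.transpose.toEuclideanLin αs ∧
      ‖R.dual n - p‖ ^ 2 * (1 + R.η / (16 * R.ℓ * theta R.D ^ 2)) ^ n ≤ 4 * R.lam ^ 2 * m := by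
  have hℓ : 0 < R.ℓ := hμ.trans_le hμℓ
  have hθ := theta_pos hD
  induction n with
  | zero =>
    exact ⟨αs, hαs, rfl, by simpa using norm_sub_sq_le_of_mem_box (dual_mem_box hlam h0 0) hαs⟩
  | succ n ih =>
    obtain ⟨p, hp, hpeq, hpn⟩ := ih fun t ht => hn t (ht.trans n.le_succ)
    obtain ⟨b, hb, hβ⟩ := primal_isApproxMinimizer hf hμ hμℓ hr n
    obtain ⟨b', hb', hβ'⟩ := primal_isApproxMinimizer hf hμ hμℓ hr (n + 1)
    have hmem := dual_mem_box hlam h0 (n + 1)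
    have hstep : ‖R.dual (n + 1) - p‖ ^ 2 ≤ _ :=
      dual_step hf hμ hℓ hlam hη hησ hβs hVI hb hβ hb' hp hpeq
    obtain ⟨hg1, hg2⟩ := dual_gap_bounds hf hℓ hβs (hVI _ hmem) hb'
    change _ ≤ ‖R.dual n - p‖ ^ 2 -
      R.η * (lagrangian R.f R.D αs βstar - lagrangian R.f R.D (R.dual (n + 1)) b') + _ at hstep
    set Δ := lagrangian R.f R.D αs βstar - lagrangian R.f R.D (R.dual (n + 1)) b' with hΔ
    have hfar : ε / 4 ≤ ‖b' - βstar‖ ^ 2 := by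
      have h1 := hn (n + 1) le_rfl
      have h2 := norm_sub_le_norm_sub_add_norm_sub (R.primal (n + 1)) b' βstar
      have h3 : Real.sqrt ε < ‖R.primal (n + 1) - βstar‖ :=
        lt_of_pow_lt_pow_left₀ 2 (norm_nonneg _) (by rwa [Real.sq_sqrt hε.le])
      have h5 : Real.sqrt ε / 2 ≤ ‖b' - βstar‖ := by linarith
      have h6 := pow_le_pow_left₀ (by positivity) h5 2
      rw [div_pow, Real.sq_sqrt hε.le] at h6
      linarith
    -- With `htol` this gives `ℓ r² ≤ Δ/17`, so the inexactness costs at most half of the decrease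
    -- `η Δ`.
    have hΔε : R.μ * ε / 8 ≤ Δ := by nlinarith
    have hdec : ‖R.dual (n + 1) - p‖ ^ 2 ≤ ‖R.dual n - p‖ ^ 2 - R.η * Δ / 2 := by
      have : R.η * (R.ℓ * R.epsHat ^ 2) ≤ R.η * (Δ / 4) :=
        mul_le_mul_of_nonneg_left (by nlinarith [sq_nonneg R.epsHat]) hη.le
      linarith
    obtain ⟨q, hq, hqeq, hqn⟩ := exists_mem_box_near hD hmem hαs
    have hqn2 : ‖R.dual (n + 1) - q‖ ^ 2 ≤ 8 * R.ℓ * theta R.D ^ 2 * Δ := by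
      have h1 := pow_le_pow_left₀ (norm_nonneg _) hqn 2
      rw [mul_pow, mul_pow] at h1
      rw [div_le_iff₀ (by positivity)] at hg1
      nlinarith [mul_le_mul_of_nonneg_left hg1 (sq_nonneg (theta R.D))]
    set x := R.η / (16 * R.ℓ * theta R.D ^ 2) with hx
    have hx0 : 0 < x := by positivity
    have hxΔ : x * (8 * R.ℓ * theta R.D ^ 2 * Δ) = R.η * Δ / 2 := by
      rw [hx]
      field_simp
      ring
    -- The nearer of the old reference point and the Hoffman point replaces a projection onto the
    -- dual optimal set.
    have hclose : ∃ p' ∈ box m R.lam,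
        R.D.transpose.toEuclideanLin p' = R.D.transpose.toEuclideanLin αs ∧
          ‖R.dual (n + 1) - p'‖ ^ 2 ≤ ‖R.dual (n + 1) - p‖ ^ 2 ∧
          ‖R.dual (n + 1) - p'‖ ^ 2 ≤ ‖R.dual (n + 1) - q‖ ^ 2 := by
      rcases le_total (‖R.dual (n + 1) - p‖ ^ 2) (‖R.dual (n + 1) - q‖ ^ 2) with h | h
      · exact ⟨p, hp, hpeq, le_rfl, h⟩
      · exact ⟨q, hq, hqeq, h, le_rfl⟩
    obtain ⟨p', hp', hp'eq, h1, h2⟩ := hclose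
    refine ⟨p', hp', hp'eq, ?_⟩
    have h3 : ‖R.dual (n + 1) - p'‖ ^ 2 * (1 + x) ≤ ‖R.dual n - p‖ ^ 2 := by
      have := mul_le_mul_of_nonneg_left (h2.trans hqn2) hx0.le
      linarith
    calc ‖R.dual (n + 1) - p'‖ ^ 2 * (1 + x) ^ (n + 1)
        = ‖R.dual (n + 1) - p'‖ ^ 2 * (1 + x) * (1 + x) ^ n := by ring
      _ ≤ ‖R.dual n - p‖ ^ 2 * (1 + x) ^ n := by gcongr
      _ ≤ 4 * R.lam ^ 2 * m := hpn

/-- An inaccurate iterate forces `√ε/2 < ‖β*(α_n) - β*‖ ≤ √σ ‖α_n - p‖ / μ`, against the geometric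
decay of `‖α_n - p‖`. -/
theorem pow_lt_of_inaccurate (hf : IsRegularLoss R.f R.μ R.ℓ) (hμ : 0 < R.μ) (hμℓ : R.μ ≤ R.ℓ)
    (hD : R.D ≠ 0) (hlam : 0 < R.lam) (h0 : R.α₀ ∈ box m R.lam) (hη : 0 < R.η)
    (hησ : R.η * sigmaMax R.D ≤ R.μ) (hr : 0 < R.epsHat) {ε : ℝ} (hε : 0 < ε)
    (hrε : R.epsHat ≤ Real.sqrt ε / 2) (htol : 136 * (R.ℓ * R.epsHat ^ 2) ≤ R.μ * ε)
    {βstar : EuclideanSpace ℝ (Fin d)}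
    (hβ : IsMinOn (objective R.f R.D R.lam) Set.univ βstar) {n : ℕ}
    (hn : ∀ t ≤ n, ε < ‖R.primal t - βstar‖ ^ 2) :
    (1 + R.η / (16 * R.ℓ * theta R.D ^ 2)) ^ n <
      16 * sigmaMax R.D * R.lam ^ 2 * m / (R.μ ^ 2 * ε) := by
  have hℓ : 0 < R.ℓ := hμ.trans_le hμℓ
  have hθ := theta_pos hD
  have hσ := sigmaMax_pos hD
  obtain ⟨αs, hαs, hβs, hVI⟩ := exists_dual_optimal (D := R.D) hf hμ hlam hβ
  obtain ⟨p, hp, hpeq, hpn⟩ :=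
    exists_dual_near hf hμ hμℓ hD hlam h0 hη hησ hr hε hrε htol hαs hβs hVI n hn
  obtain ⟨b, hb, hβb⟩ := primal_isApproxMinimizer hf hμ hμℓ hr n
  rw [← lagrangian_congr hpeq] at hβs
  have h1 := norm_minimizer_sub_le_sqrt hf hμ hβs hb
  have h2 := norm_sub_le_norm_sub_add_norm_sub (R.primal n) b βstar
  have h3 : Real.sqrt ε < ‖R.primal n - βstar‖ := 
    lt_of_pow_lt_pow_left₀ 2 (norm_nonneg _) (by rw [Real.sq_sqrt hε.le]; exact hn n le_rfl)
  rw [norm_sub_rev] at h1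
  have h5 : Real.sqrt ε / 2 <
      Real.sqrt (sigmaMax R.D * ‖R.dual n - p‖ ^ 2) / R.μ := by linarith
  have h6 := pow_lt_pow_left₀ h5 (by positivity) two_ne_zero
  rw [div_pow, div_pow, Real.sq_sqrt hε.le, Real.sq_sqrt (by positivity),
    div_lt_div_iff₀ (by positivity) (by positivity)] at h6
  set y := (1 + R.η / (16 * R.ℓ * theta R.D ^ 2)) ^ n with hy
  have hy0 : 0 < y := by positivity
  rw [lt_div_iff₀ (by positivity)]
  have h7 := mul_lt_mul_of_pos_right h6 hy0
  have h8 := mul_le_mul_of_nonneg_left hpn hσ.le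
  nlinarith

end Run

end GDGA

end

/-! ### The total count of oracle calls. -/

theorem theorem4 :
    ∃ C : ℝ, 0 < C ∧
      ∀ (m d : ℕ) (R : GDGA.Run m d) (σ κ τ ε : ℝ)
        (βstar b₀ : EuclideanSpace ℝ (Fin d)),
        0 < R.μ →
        GDGA.IsRegularLoss R.f R.μ R.ℓ →
        R.D ≠ 0 →
        0 < R.lam →
        σ = GDGA.sigmaMax R.D →
        κ = R.ℓ / R.μ →
        τ = GDGA.tau R.D R.μ R.ℓ →
        0 < R.η →
        R.η < R.μ / (4 * σ) →
        R.α₀ ∈ GDGA.box m R.lam →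
        0 < ε →
        0 < R.epsHat →
        R.epsHat < 1 →
        R.epsHat ≤ min (Real.sqrt ε / 2)
          (R.μ * Real.sqrt ε / (4 * Real.sqrt R.ℓ) *
            Real.sqrt (τ / (GDGA.tolConst τ σ κ * (17 * τ ^ 2 + (14 + R.η) * τ + 1)))) →
        IsMinOn (GDGA.objective R.f R.D R.lam) Set.univ βstar →
        IsMinOn (GDGA.lagrangian R.f R.D R.α₀) Set.univ b₀ →
        (∀ t : ℕ,
          GDGA.IsApproxMinimizer (GDGA.lagrangian R.f R.D (R.dual t)) R.epsHat (R.primal t)) ∧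
        ∃ T : ℕ, ‖R.primal T - βstar‖ ^ 2 ≤ ε ∧
          (R.totalCalls T : ℝ) ≤
            C * (Real.sqrt κ * (17 * τ ^ 2 + 14 * τ + 1) / (τ * R.η) *
                  Real.posLog (64 * R.ℓ * σ * R.lam ^ 2 * m / (R.μ ^ 3 * ε)) *
                  Real.log ((1 + 2 * R.lam * Real.sqrt (σ * m) / R.μ) / R.epsHat) +
                Real.sqrt κ * Real.log (1 + ‖R.βinit - b₀‖ / R.epsHat)) := by
  
  -- `60 = 3 · 20`: at most `3 K P` warm-started runs, each costing at most `20 √κ` times the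
  -- logarithm. The first run needs only `10`.
  refine ⟨60, by norm_num, ?_⟩
  intro m d R σ κ τ ε βstar b₀ hμ hf hD hlam hσdef hκdef hτdef hη hησ hα₀ hε hr hr1 htol hβ hb₀
  obtain ⟨j, hj⟩ := GDGA.exists_row_ne_zero hD
  have hd : 0 < d := by
    rcases Nat.eq_zero_or_pos d with rfl | h
    · exact absurd (Subsingleton.elim _ _) hj
    · exact h
  have hμℓ : R.μ ≤ R.ℓ := hf.modulus_le hd
  have hℓ : 0 < R.ℓ := hμ.trans_le hμℓ
  have hσ : 0 < σ := hσdef ▸ GDGA.sigmaMax_pos hD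
  have hθσ := GDGA.one_le_theta_sq_mul_sigmaMax hD
  have hθ := GDGA.theta_pos hD
  have hκ : 1 ≤ κ := hκdef ▸ (one_le_div hμ).2 hμℓ
  rw [← hσdef] at hθσ
  have hτℓ : GDGA.theta R.D ^ 2 * R.ℓ ≤ τ := by
    rw [hτdef, GDGA.tau, ← hσdef]
    refine le_mul_of_one_le_right (by positivity) ?_
    have : 0 < σ / R.μ := by positivity
    linarith
  have hτ : 0 < τ := lt_of_lt_of_le (by positivity) hτℓ
  have hτσ : R.ℓ ≤ τ * σ := by
    have h1 := mul_le_mul_of_nonneg_right hτℓ hσ.le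
    have h2 := mul_le_mul_of_nonneg_left hθσ hℓ.le
    linarith
  rw [lt_div_iff₀ (by positivity)] at hησ
  have hησ' : R.η * GDGA.sigmaMax R.D ≤ R.μ := by
    rw [← hσdef]
    have : 0 < R.η * σ := by positivity
    linarith
  obtain ⟨hrε, htol'⟩ := le_min_iff.1 htol
  rw [hκdef] at htol'
  have htol2 := GDGA.sq_tolerance_le hμ hℓ hτ hσ hη hε hr hτσ htol'
  refine ⟨GDGA.Run.primal_isApproxMinimizer hf hμ hμℓ hr, ?_⟩
  set x := R.η / (16 * R.ℓ * GDGA.theta R.D ^ 2) with hx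
  have hx0 : 0 < x := by positivity
  set W := 16 * σ * R.lam ^ 2 * m / (R.μ ^ 2 * ε) with hW
  have hpow : ∀ n, (∀ t ≤ n, ε < ‖R.primal t - βstar‖ ^ 2) → (1 + x) ^ n < W := by
    intro n hn
    rw [hW, hσdef]
    exact GDGA.Run.pow_lt_of_inaccurate hf hμ hμℓ hD hlam hα₀ hη hησ' hr hε hrε htol2 hβ hn
  have hex : ∃ T, ‖R.primal T - βstar‖ ^ 2 ≤ ε := by
    by_contra hc
    push Not at hc
    obtain ⟨n, hn⟩ := pow_unbounded_of_one_lt W (show 1 < 1 + x by linarith)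
    exact absurd (hpow n fun t _ => hc t) hn.not_gt
  classical
  have hT := Nat.find_spec hex
  have hTmin : ∀ t < Nat.find hex, ε < ‖R.primal t - βstar‖ ^ 2 :=
    fun t ht => not_le.1 (Nat.find_min hex ht)
  refine ⟨Nat.find hex, hT, ?_⟩
  generalize Nat.find hex = T at hT hTmin
  have hfirst : (R.calls 0 : ℝ) ≤
      10 * (Real.sqrt κ * Real.log (1 + ‖R.βinit - b₀‖ / R.epsHat)) := by
    rw [hκdef]
    exact GDGA.innerCalls_le hf hμ hμℓ R.βinit hr hb₀
  have hlog0 : 0 ≤ Real.sqrt κ * Real.log (1 + ‖R.βinit - b₀‖ / R.epsHat) := by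
    have : 0 ≤ ‖R.βinit - b₀‖ / R.epsHat := by positivity
    exact mul_nonneg (Real.sqrt_nonneg _) (Real.log_nonneg (by linarith))
  set X := 2 * R.lam * Real.sqrt (σ * m) / R.μ with hX
  have hX0 : 0 ≤ X := by positivity
  have hLg : 0 ≤ Real.log ((1 + X) / R.epsHat) :=
    Real.log_nonneg ((one_le_div hr).2 (by linarith))
  set K := (17 * τ ^ 2 + 14 * τ + 1) / (τ * R.η) with hK
  have hK0 : 17 * τ / R.η ≤ K := by
    have : 17 * τ / R.η = 17 * τ ^ 2 / (τ * R.η) := by field_simp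
    rw [this]
    exact div_le_div_of_nonneg_right (by linarith) (by positivity)
  have hsplit : Real.sqrt κ * (17 * τ ^ 2 + 14 * τ + 1) / (τ * R.η) = Real.sqrt κ * K :=
    mul_div_assoc _ _ _
  rw [GDGA.Run.totalCalls, Finset.sum_range_succ', hsplit]
  push_cast
  -- For `T = 0` only the first run counts. For `T = n + 1` the iterates `0, …, n` are inaccurate
  -- and there are `n + 1` warm-started runs.
  rcases T with _ | n
  · have h1 : 0 ≤ Real.sqrt κ * K *
        Real.posLog (64 * R.ℓ * σ * R.lam ^ 2 * m / (R.μ ^ 3 * ε)) *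
          Real.log ((1 + X) / R.epsHat) := by
      have := Real.posLog_nonneg (x := 64 * R.ℓ * σ * R.lam ^ 2 * m / (R.μ ^ 3 * ε))
      positivity
    simp only [Finset.range_zero, Finset.sum_empty, zero_add]
    linarith
  · have hKx : 1 / x ≤ K := by
      refine le_trans ?_ hK0
      rw [hx, one_div_div]
      exact div_le_div_of_nonneg_right (by linarith) hη.le
    -- `4 η σ < μ ≤ ℓ ≤ τ σ` gives `η ≤ 17 τ`.
    have hK1 : 1 ≤ K := by
      refine le_trans ?_ hK0
      rw [one_le_div hη]
      refine le_of_mul_le_mul_right ?_ hσ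
      nlinarith
    obtain ⟨hW1, hn⟩ := GDGA.pow_lt_imp_le_mul_log hx0 hKx hK1 hκ
      (hpow n fun t ht => hTmin t (Nat.lt_succ_of_le ht))
    have harg : 4 * κ * W = 64 * R.ℓ * σ * R.lam ^ 2 * m / (R.μ ^ 3 * ε) := by
      rw [hκdef, hW]
      field_simp
      ring
    rw [harg] at hn
    have hpl : Real.log (64 * R.ℓ * σ * R.lam ^ 2 * m / (R.μ ^ 3 * ε)) ≤
        Real.posLog (64 * R.ℓ * σ * R.lam ^ 2 * m / (R.μ ^ 3 * ε)) := le_max_right _ _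
    set P := Real.posLog (64 * R.ℓ * σ * R.lam ^ 2 * m / (R.μ ^ 3 * ε))
    have hn' : (n : ℝ) + 1 ≤ 3 * (K * P) :=
      hn.trans (by gcongr)
    -- `X² = ε W / 4` and `W > 1`, so `X ≥ √ε/2`.
    have hrX : R.epsHat ≤ X := by
      refine hrε.trans (Real.le_sqrt_of_sq_le ?_ |>.trans (Real.sqrt_sq hX0).le)
      have h1 : X ^ 2 = ε * W / 4 := by
        rw [hX, hW, div_pow, mul_pow, mul_pow, Real.sq_sqrt (by positivity)]
        field_simp
        ring
      rw [div_pow, Real.sq_sqrt hε.le, h1]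
      have h2 := mul_le_mul_of_nonneg_left hW1.le hε.le
      linarith only [h2]
    have hcall : ∀ t ∈ Finset.range (n + 1), (R.calls (t + 1) : ℝ) ≤
        20 * (Real.sqrt κ * Real.log ((1 + X) / R.epsHat)) := by
      intro t _
      have h1 := GDGA.Run.calls_succ_le hf hμ hμℓ hlam hα₀ (hσdef ▸ hσ) hr t
      rw [← hσdef, ← hκdef, ← hX] at h1
      have h2 := mul_le_mul_of_nonneg_left (GDGA.log_restart_le hr hr1 hrX) (Real.sqrt_nonneg κ)
      linarith only [h1, h2]
    have hsum := Finset.sum_le_card_nsmul _ _ _ hcall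
    rw [Finset.card_range, nsmul_eq_mul] at hsum
    push_cast at hsum
    have h3 : ((n : ℝ) + 1) * (20 * (Real.sqrt κ * Real.log ((1 + X) / R.epsHat))) ≤
        3 * (K * P) * (20 * (Real.sqrt κ * Real.log ((1 + X) / R.epsHat))) := by gcongr
    refine (add_le_add (hsum.trans h3) hfirst).trans ?_
    linarith only [hlog0]
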